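/- **Setting.** Let $H=\sum_{l=1}^m\alpha_lP_l$ be an $n$-qubit observable with $\alpha_l>0$ and $P_l$ signed tensor products of Pauli operators, let $|\Psi\rangle$ be a unit vector, and let $A_j=\sum_{k}\beta^{(j)}_kQ^{(j)}_k$ ($1\le j\le p$, $\beta^{(j)}_k>0$, $Q^{(j)}_k$ signed Pauli products) be pulse generators. For $\theta\in\mathbb R^p$ put $U_{a:b}=e^{-iA_b\theta_b/2}\cdots e^{-iA_a\theta_a/2}$, $|\theta\rangle=U_{1:p}|\Psi\rangle$ and $f(\theta)=\langle\theta|H|\theta\rangle$. Let $\gamma^{(j)}_{kl}=\beta^{(j)}_k\alpha_l$ if the qubits of $U_{j+1:p}Q^{(j)}_kU_{j+1:p}^\dagger$ (found by starting from the qubits of $Q_k^{(j)}$ and going through the pulses $j+1,\dots,p$, where a pulse on qubits disjoint from those collected so far cancels, and otherwise its qubits are added) meet the qubits of $P_l$, and $\gamma^{(j)}_{kl}=0$ otherwise. Let $\Gamma_j=\sum_{k,l}\gamma^{(j)}_{kl}$ and $\vec\Gamma=(\Gamma_1,\dots,\Gamma_p)$. A first-order query $(\theta,j)$ samples $(k,l)$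 with probability $\gamma^{(j)}_{kl}/\Gamma_j$, measures the $\pm1$ outcome of the Hadamard test for $-\operatorname{Im}\langle\Psi|U_{1:j}^\dagger Q^{(j)}_kU_{j+1:p}^\dagger P_lU_{1:p}|\Psi\rangle$, and returns the outcome times $\Gamma_j$. An *SMD-type algorithm* on a closed convex set $\mathcal X\subseteq\mathbb R^p$ starts at some $x_0\in\mathcal X$. In each round $t=0,\dots,T-1$ it queries every coordinate $j$ independently $N_j=\lceil\kappa\,p\,\Gamma_j^2/\|\vec\Gamma\|_2^2\rceil$ times at $x_t$ ($\ell_2$-sampling with batch multiplier $\kappa>0$), lets $\hat g_{t,j}$ be the average of the answers ($0$ if $N_j=0$), and sets $$x_{t+1}=\operatorname*{argmin}_{x\in\mathcal X}\bigl[\eta_t\,\hat g_t^{\top}x+D_{\Phi_t}(x,x_t)\bigr],$$ where $\eta_t>0$, $D_\Phi$ is the Bregman divergence, and the mirror map $\Phi_t:\mathbb R^p\to\mathbb R$ (differentiable, strictly convex, with surjective gradient) may depend on $x_0,\dots,x_t$. Its output $\bar\theta$ is a fixed convex combination of $x_0,\dots,x_T$; it makes $T\sum_jN_j$ queries. **Lemma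 (SMD bound, strongly convex case).** There is an absolute constant $C$ such that for all $p\ge1$, every nonempty closed convex $\mathcal X\subseteq\mathbb R^p$, every $\vec\Gamma$, and all $\lambda_1,\epsilon>0$ there is an SMD-type algorithm, depending only on $p,\mathcal X,\vec\Gamma,\lambda_1,\epsilon$, that makes at most $$C\,\frac{\|\vec\Gamma\|_2^2}{\epsilon\lambda_1}\Bigl[1+\ln\Bigl(4p^2\frac{\|\vec\Gamma\|_\infty^2}{\|\vec\Gamma\|_2^2}\Bigr)\Bigr]$$ first-order queries ($0$ if $\vec\Gamma=0$) and, for $p\ge2$, at most $C\,\|\vec\Gamma\|_2^2\ln p/(\epsilon\lambda_1)$ of them, with the following property. For every $n$, every $H$, $|\Psi\rangle$ and $A_1,\dots,A_p$ on $n$ qubits whose vector of normalization factors is $\vec\Gamma$: if $f$ is $\lambda_1$-strongly convex on $\mathcal X$ with respect to $\|\cdot\|_1$, i.e. $f(y)\ge f(x)+\nabla f(x)^\top(y-x)+\frac{\lambda_1}2\|x-y\|_1^2$ for all $x,y\in\mathcal X$, and $\|\nabla f(\theta)\|_\infty\le\|\vec\Gamma\|_2/\sqrt{2p}$ for all $\theta\in\mathcal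 X$, then $f$ has a minimizer $\theta^*$ on $\mathcal X$ and $\mathbb E f(\bar\theta)-f(\theta^*)\le\epsilon$. -/

import Mathlib

open scoped Matrix

/-! ### Pauli operators, observables and parameterizations -/

/-- The four single-qubit Pauli labels. -/
inductive Pauli : Type
  | I
  | X
  | Y
  | Z

/-- The `2 × 2` matrix of a single-qubit Pauli operator. -/
noncomputable def Pauli.mat : Pauli → Matrix (Fin 2) (Fin 2) ℂ
  | Pauli.I => 1
  | Pauli.X => !![0, 1; 1, 0]
  | Pauli.Y => !![0, -Complex.I; Complex.I, 0]
  | Pauli.Z => !![1, 0; 0, -1]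

/-- Computational basis labels of an `n`-qubit register. -/
abbrev Bits (n : ℕ) : Type := Fin n → Fin 2

/-- The tensor product of the single-qubit Pauli operators `w 0, …, w (n-1)`. -/
noncomputable def pauliWord {n : ℕ} (w : Fin n → Pauli) : Matrix (Bits n) (Bits n) ℂ :=
  Matrix.of fun a b => ∏ q, (w q).mat (a q) (b q)

/-- The qubits on which a tensor product of Pauli operators acts nontrivially. -/
def wordQubits {n : ℕ} (w : Fin n → Pauli) : Set (Fin n) := {q | w q ≠ Pauli.I}

/-- A Hermitian `n`-qubit operator given by a Pauli expansion `∑ i, coeff i • (± pauliWord)` with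
positive coefficients, the signs being absorbed into the Pauli products. -/
structure PauliExpansion (n : ℕ) where
  card : ℕ
  coeff : Fin card → ℝ
  coeff_pos : ∀ i, 0 < coeff i
  sign : Fin card → ℤˣ
  word : Fin card → Fin n → Pauli

namespace PauliExpansion

variable {n : ℕ}

/-- The `i`-th (signed) Pauli product of the expansion. -/
noncomputable def term (A : PauliExpansion n) (i : Fin A.card) : Matrix (Bits n) (Bits n) ℂ :=
  (((A.sign i : ℤˣ) : ℤ) : ℂ) • pauliWord (A.word i)

/-- The operator described by the expansion. -/
noncomputable def op (A : PauliExpansion n) : Matrix (Bits n) (Bits n) ℂ :=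
  ∑ i, (A.coeff i : ℂ) • A.term i

/-- The qubits on which the operator acts, i.e. those occurring in one of its Pauli products. -/
def qubits (A : PauliExpansion n) : Set (Fin n) := ⋃ i, wordQubits (A.word i)

end PauliExpansion

/-- A `p`-parameter state parameterization on `n` qubits: a unit starting state and the pulse
generators `A_1, …, A_p`. -/
structure Parameterization (n p : ℕ) where
  init : Bits n → ℂ
  init_norm : ∑ b, ‖init b‖ ^ 2 = 1
  gen : Fin p → PauliExpansion n

namespace Parameterization

variable {n p : ℕ}

/-- The pulse `exp (-i A_j θ_j / 2)`. -/
noncomputable def pulse (Θ : Parameterization n p) (θ : Fin p → ℝ) (j : Fin p) :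
    Matrix (Bits n) (Bits n) ℂ :=
  NormedSpace.exp ((-(Complex.I * (θ j : ℂ) / 2)) • (Θ.gen j).op)

/-- The pulses listed in `l`, applied in the order of the list (the first one acts first). -/
noncomputable def evolve (Θ : Parameterization n p) (θ : Fin p → ℝ) (l : List (Fin p)) :
    Matrix (Bits n) (Bits n) ℂ :=
  (l.reverse.map (Θ.pulse θ)).prod

/-- The indices `1, …, j`. -/
def upTo (j : Fin p) : List (Fin p) := (List.finRange p).filter (fun i => i ≤ j)

/-- The indices `j + 1, …, p`. -/
def after (j : Fin p) : List (Fin p) := (List.finRange p).filter (fun i => j < i)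

/-- The trial state `exp (-i A_p θ_p / 2) ⋯ exp (-i A_1 θ_1 / 2) |Ψ⟩`. -/
noncomputable def state (Θ : Parameterization n p) (θ : Fin p → ℝ) : Bits n → ℂ :=
  Θ.evolve θ (List.finRange p) *ᵥ Θ.init

/-- The induced objective function `f(θ) = ⟨θ|H|θ⟩`. -/
noncomputable def objective (Θ : Parameterization n p) (H : PauliExpansion n)
    (θ : Fin p → ℝ) : ℝ :=
  (star (Θ.state θ) ⬝ᵥ (H.op *ᵥ Θ.state θ)).re

/-! ### The coefficients `γ` and `Γ` -/

open Classical in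
/-- The qubits of `U_{(j+1):p} Q_k^{(j)} U_{(j+1):p}†`, after removing the pulses that trivially
commute through and cancel: going through the pulses `j+1, …, p` (from the inside to the outside of
the conjugation), a pulse that acts on qubits disjoint from the ones collected so far cancels
against its inverse; the qubits of the other pulses are added. -/
noncomputable def cone (Θ : Parameterization n p) (j : Fin p) (k : Fin (Θ.gen j).card) :
    Set (Fin n) :=
  (after j).foldl
    (fun S i => if Disjoint (Θ.gen i).qubits S then S else S ∪ (Θ.gen i).qubits)
    (wordQubits ((Θ.gen j).word k))

open Classical in
/-- `γ_{kl}^{(j)}`: equal to `β_k^{(j)} α_l`, or to `0` if the two operators act on disjoint sets of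
qubits. -/
noncomputable def gammaCoeff (Θ : Parameterization n p) (H : PauliExpansion n) (j : Fin p)
    (k : Fin (Θ.gen j).card) (l : Fin H.card) : ℝ :=
  if Disjoint (Θ.cone j k) (wordQubits (H.word l)) then 0
  else (Θ.gen j).coeff k * H.coeff l

/-- `Γ_j = ∑_{k,l} γ_{kl}^{(j)}`. -/
noncomputable def Gamma (Θ : Parameterization n p) (H : PauliExpansion n) (j : Fin p) : ℝ :=
  ∑ k, ∑ l, Θ.gammaCoeff H j k l

/-! ### The first-order sampling oracle -/

/-- Apply `V` to the register `B` of a state of control qubit `A` and register `B`. -/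
noncomputable def applyB (V : Matrix (Bits n) (Bits n) ℂ) (φ : Fin 2 → Bits n → ℂ) :
    Fin 2 → Bits n → ℂ :=
  fun a => V *ᵥ φ a

/-- Apply `V` to the register `B`, controlled on the qubit `A`. -/
noncomputable def applyControlled (V : Matrix (Bits n) (Bits n) ℂ) (φ : Fin 2 → Bits n → ℂ) :
    Fin 2 → Bits n → ℂ :=
  fun a => if a = 1 then V *ᵥ φ a else φ a

/-- Born probability of the outcome `+1` (`s = true`) or `-1` (`s = false`) when Pauli `Y` is
measured on the qubit `A`; the eigenvectors are `(|0⟩ ± i|1⟩)/√2`. -/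
noncomputable def measureY (φ : Fin 2 → Bits n → ℂ) (s : Bool) : ℝ :=
  ∑ b, ‖((φ 0 b - (if s then Complex.I else -Complex.I) * φ 1 b) / (Real.sqrt 2 : ℂ))‖ ^ 2

/-- Outcome distribution of the generalized Hadamard test for the pair `(Q_k^{(j)}, P_l)`: start in
`|+⟩|Ψ⟩`, apply `U_{1:j}`, controlled-`Q_k^{(j)}`, `U_{(j+1):p}`, controlled-`P_l`, and measure `Y`
on the control qubit. -/
noncomputable def hadamardTest (Θ : Parameterization n p) (H : PauliExpansion n)
    (θ : Fin p → ℝ) (j : Fin p) (k : Fin (Θ.gen j).card) (l : Fin H.card) (s : Bool) : ℝ :=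
  measureY
    (applyControlled (H.term l)
      (applyB (Θ.evolve θ (after j))
        (applyControlled ((Θ.gen j).term k)
          (applyB (Θ.evolve θ (upTo j))
            (fun _ b => Θ.init b / (Real.sqrt 2 : ℂ)))))) s

/-- Law of the answer of the oracle to the first-order query `(Θ, θ, {j})`: sample `(k, l)` with
probability `γ_{kl}^{(j)} / Γ_j`, run the Hadamard test, and return its outcome times `Γ_j`. The
function gives the probability of the answer `+Γ_j` (`s = true`) and `-Γ_j` (`s = false`). If
`Γ_j = 0` both answers are `0`, and the label is a fair coin. -/
noncomputable def oracleProb (Θ : Parameterization n p) (H : PauliExpansion n)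
    (θ : Fin p → ℝ) (j : Fin p) (s : Bool) : ℝ :=
  if Θ.Gamma H j = 0 then 1 / 2
  else ∑ k, ∑ l, Θ.gammaCoeff H j k l / Θ.Gamma H j * Θ.hadamardTest H θ j k l s

end Parameterization

/-! ### Strong convexity with respect to the 1-norm -/

/-- `f(y) ≥ f(x) + ∇f(x)ᵀ(y - x) + (lam / 2) ‖x - y‖₁²` for all `x, y ∈ X`. -/
def StronglyConvexOneNorm {p : ℕ} (lam : ℝ) (X : Set (Fin p → ℝ)) (f : (Fin p → ℝ) → ℝ) : Prop :=
  ∀ x ∈ X, ∀ y ∈ X, f x + fderiv ℝ f x (y - x) + lam / 2 * (∑ i, |x i - y i|) ^ 2 ≤ f y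

/-! ### Stochastic mirror descent driven by first-order queries -/

/-- A mirror map on `ℝ^p` (with domain all of `ℝ^p`): differentiable, strictly convex, and with
surjective gradient. -/
structure IsMirrorMap {p : ℕ} (Φ : (Fin p → ℝ) → ℝ) : Prop where
  differentiable : Differentiable ℝ Φ
  strictConvex : StrictConvexOn ℝ Set.univ Φ
  gradient_surjective : Function.Surjective fun x => fderiv ℝ Φ x

/-- The Bregman divergence `D_Φ(x, y)`. -/
noncomputable def bregman {p : ℕ} (Φ : (Fin p → ℝ) → ℝ) (x y : Fin p → ℝ) : ℝ :=
  Φ x - (Φ y + fderiv ℝ Φ y (x - y))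

/-- `z` is the result of a projected mirror descent step from `x` with gradient estimate `g`:
`z = argmin_{y ∈ X} [η gᵀ y + D_Φ(y, x)]`. -/
def IsMirrorStep {p : ℕ} (X : Set (Fin p → ℝ)) (Φ : (Fin p → ℝ) → ℝ) (η : ℝ)
    (g x z : Fin p → ℝ) : Prop :=
  z ∈ X ∧ ∀ y ∈ X, η * (g ⬝ᵥ z) + bregman Φ z x ≤ η * (g ⬝ᵥ y) + bregman Φ y x

open Classical in
/-- The projected mirror descent step as a function (the minimizer exists and is unique for a mirror
map and a nonempty closed convex set). -/
noncomputable def mirrorStep {p : ℕ} (X : Set (Fin p → ℝ)) (Φ : (Fin p → ℝ) → ℝ) (η : ℝ)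
    (g x : Fin p → ℝ) : Fin p → ℝ :=
  if h : ∃ z, IsMirrorStep X Φ η g x z then h.choose else x

/-- The choices that specify an SMD-type algorithm on the feasible set `X ⊆ ℝ^p`: the number of
rounds, the batch multiplier of the gradient estimator, the starting point, the mirror map used in
each round (which may depend on the iterates visited so far), the step sizes, and the weights of the
convex combination of the iterates that is returned. -/
structure SMDScheme (p : ℕ) (X : Set (Fin p → ℝ)) where
  rounds : ℕ
  mult : ℝ
  start : Fin p → ℝ
  start_mem : start ∈ X
  mirror : (t : ℕ) → (Fin (t + 1) → Fin p → ℝ) → (Fin p → ℝ) → ℝ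
  mirror_isMirrorMap : ∀ t h, IsMirrorMap (mirror t h)
  step : ℕ → ℝ
  step_pos : ∀ t, 0 < step t
  weight : Fin (rounds + 1) → ℝ
  weight_nonneg : ∀ t, 0 ≤ weight t
  weight_sum : ∑ t, weight t = 1

/-- Number of queries to coordinate `j` in one call of the `ℓ₂`-sampling gradient estimator with
batch multiplier `κ`: `N_j = ⌈p (Γ_j² / ‖Γ‖₂²) κ⌉`. -/
noncomputable def batchSize {p : ℕ} (G : Fin p → ℝ) (κ : ℝ) (j : Fin p) : ℕ :=
  ⌈(p : ℝ) * (G j ^ 2 / ∑ i, G i ^ 2) * κ⌉₊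

/-- The signs of the oracle answers received in one call of the estimator. -/
abbrev BatchOutcome {p : ℕ} (G : Fin p → ℝ) (κ : ℝ) : Type :=
  (j : Fin p) → Fin (batchSize G κ j) → Bool

/-- The gradient estimate: in coordinate `j`, the average of the `N_j` answers `±Γ_j` (and `0` if
`N_j = 0`). -/
noncomputable def gradEstimate {p : ℕ} (G : Fin p → ℝ) (κ : ℝ) (o : BatchOutcome G κ) :
    Fin p → ℝ :=
  fun j => (∑ i, if o j i then G j else -G j) / (batchSize G κ j : ℝ)

namespace SMDScheme

variable {p : ℕ} {X : Set (Fin p → ℝ)}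

/-- The iterates `x_0, …, x_t` produced from the gradient estimates `g 0, …, g (t-1)`. -/
noncomputable def trajectory (S : SMDScheme p X) (g : ℕ → Fin p → ℝ) :
    (t : ℕ) → Fin (t + 1) → Fin p → ℝ
  | 0 => fun _ => S.start
  | t + 1 =>
    let h := S.trajectory g t
    Fin.snoc (α := fun _ => Fin p → ℝ) h
      (mirrorStep X (S.mirror t h) (S.step t) (g t) (h (Fin.last t)))

/-- The oracle answers (signs) received during the whole run. -/
abbrev Outcome (S : SMDScheme p X) (G : Fin p → ℝ) : Type :=
  Fin S.rounds → BatchOutcome G S.mult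

/-- The sequence of gradient estimates of a run. -/
noncomputable def estimates (S : SMDScheme p X) (G : Fin p → ℝ) (ω : S.Outcome G) :
    ℕ → Fin p → ℝ :=
  fun t => if h : t < S.rounds then gradEstimate G S.mult (ω ⟨t, h⟩) else 0

/-- The iterates `x_0, …, x_T` of a run. -/
noncomputable def iterates (S : SMDScheme p X) (G : Fin p → ℝ) (ω : S.Outcome G) :
    Fin (S.rounds + 1) → Fin p → ℝ :=
  S.trajectory (S.estimates G ω) S.rounds

/-- The returned parameter. -/
noncomputable def output (S : SMDScheme p X) (G : Fin p → ℝ) (ω : S.Outcome G) : Fin p → ℝ :=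
  ∑ t, S.weight t • S.iterates G ω t

/-- The total number of first-order queries. -/
noncomputable def queries (S : SMDScheme p X) (G : Fin p → ℝ) : ℕ :=
  S.rounds * ∑ j, batchSize G S.mult j

/-- The probability of a run: in round `t` the oracle is queried at the current iterate `x_t`, and
all its answers are independent given the past. -/
noncomputable def runProb {n : ℕ} (S : SMDScheme p X) (Θ : Parameterization n p)
    (H : PauliExpansion n) (ω : S.Outcome (Θ.Gamma H)) : ℝ :=
  ∏ t, ∏ j, ∏ i, Θ.oracleProb H (S.iterates (Θ.Gamma H) ω (Fin.castSucc t)) j (ω t j i)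

/-- The expected objective value of the returned parameter. -/
noncomputable def expectedValue {n : ℕ} (S : SMDScheme p X) (Θ : Parameterization n p)
    (H : PauliExpansion n) : ℝ :=
  ∑ ω : S.Outcome (Θ.Gamma H),
    S.runProb Θ H ω * Θ.objective H (S.output (Θ.Gamma H) ω)

end SMDScheme

/-!
# Stochastic mirror descent for objectives that are strongly convex in the 1-norm

Write `ℓ = 1 + log p` and `M² = ‖Γ‖₂² / p`. Both claimed query bounds are of the order
`‖Γ‖₂² ℓ / (ε λ)`.

*The oracle.* The derivative of the objective along `θ_j` is a combination of the imaginary parts of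
the overlaps that the Hadamard test samples. A pair `(k, l)` with `γ_{kl} = 0` contributes nothing:
the conjugated term `Q_k` commutes with every Pauli product away from its light cone
(`Parameterization.actsOn_conj_evolve`), so `P_l` times it is Hermitian and its expectation is real.
Hence the oracle is unbiased (`Parameterization.oracleProb_sub`). With batch multiplier `1`, a round
costs at most `2p` queries, and every coordinate of the estimate is sub-Gaussian with variance proxy
of order `M²` (`sum_batchLaw_mul_cosh_le`). It remains to reach accuracy `ε` in `O(ℓ M² / (λ ε))`
rounds.

*The mirror map.* The hyperbolic entropy at scale `b` is the function with derivative
`arsinh (y / b)`. If `b` is `ρ / p`, its divergence from the center to a point at 1-distance `r` is at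
most `r log p + 2 r² / ρ` (`sum_hypDiv_zero_le`). Since it is a sum over the coordinates with dual
`b cosh`, the error of a step of size `η` is at most a local norm `∑ⱼ (2 |xⱼ| + bⱼ)` times
`cosh (η ĝⱼ) - 1` (`mul_sub_sub_hypDiv_le`), whose expectation is of order `η² M²`. Neither the
estimation of the gradient nor the curvature of the mirror map costs a logarithm here; the only factor
`log p` comes from the size of the entropy.

*Recentering without restarts.* To benefit from strong convexity the entropy has to be centered near
the minimizer. The mirror map of round `t` is the superposition of the entropies centered at all
iterates `x_0, …, x_t`, with weight `s + 1` and scale proportional to `1 / (s + 2)` at `x_s`. Adding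
the center `x_t` raises the divergence of the minimizer from `x_t` only by the divergence from a
center, and the error of a step is an average over the centers, because the maximum of an average is
at most the average of the maxima (`mirrorStep_hypMirror_le`). Both are controlled by the 1-distances
of the iterates to the minimizer, and the quadratic gain from strong convexity absorbs them
(`drift_le`). So a potential decreases in conditional expectation by the weighted optimality gap, up
to a constant (`SMDScheme.sum_runProb_mul_gap_le`), and averaging the iterates with Jensen's
inequality gives the rate.

If `M² ≤ 4 λ ε`, any starting point is accurate, and no query is made; this includes the case `Γ = 0`.
-/

/-! ### Pauli products -/

/-- The tensor product of the `2 × 2` matrices `M 0, …, M (n-1)`. -/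
noncomputable def tensorMat {n : ℕ} (M : Fin n → Matrix (Fin 2) (Fin 2) ℂ) :
    Matrix (Bits n) (Bits n) ℂ :=
  Matrix.of fun a b => ∏ q, M q (a q) (b q)

theorem tensorMat_mul {n : ℕ} (M N : Fin n → Matrix (Fin 2) (Fin 2) ℂ) :
    tensorMat M * tensorMat N = tensorMat fun q => M q * N q := by
  ext a b
  simp only [tensorMat, Matrix.mul_apply, Matrix.of_apply]
  rw [Fintype.prod_sum]
  exact Finset.sum_congr rfl fun c _ => (Finset.prod_mul_distrib).symm

theorem tensorMat_one (n : ℕ) :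
    tensorMat (fun _ : Fin n => (1 : Matrix (Fin 2) (Fin 2) ℂ)) = 1 := by
  ext a b
  simp only [tensorMat, Matrix.of_apply, Matrix.one_apply]
  by_cases h : a = b
  · simp [h]
  · obtain ⟨q, hq⟩ := Function.ne_iff.1 h
    rw [if_neg h]
    exact Finset.prod_eq_zero (Finset.mem_univ q) (if_neg hq)

theorem tensorMat_conjTranspose {n : ℕ} (M : Fin n → Matrix (Fin 2) (Fin 2) ℂ) :
    (tensorMat M)ᴴ = tensorMat fun q => (M q)ᴴ := by
  ext a b
  simp [tensorMat, Matrix.conjTranspose_apply]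

theorem pauliWord_eq_tensorMat {n : ℕ} (w : Fin n → Pauli) :
    pauliWord w = tensorMat fun q => (w q).mat := rfl

theorem Pauli.mat_conjTranspose (P : Pauli) : P.matᴴ = P.mat := by
  cases P <;> ext i j <;> fin_cases i <;> fin_cases j <;> simp [Pauli.mat]

theorem Pauli.mat_mul_self (P : Pauli) : P.mat * P.mat = 1 := by
  cases P <;> ext i j <;> fin_cases i <;> fin_cases j <;>
    simp [Pauli.mat, Matrix.mul_apply, Fin.sum_univ_two]

theorem pauliWord_isHermitian {n : ℕ} (w : Fin n → Pauli) : (pauliWord w).IsHermitian := by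
  rw [Matrix.IsHermitian, pauliWord_eq_tensorMat, tensorMat_conjTranspose]
  simp only [Pauli.mat_conjTranspose]

theorem pauliWord_mul_self {n : ℕ} (w : Fin n → Pauli) : pauliWord w * pauliWord w = 1 := by
  rw [pauliWord_eq_tensorMat, tensorMat_mul]
  simp only [Pauli.mat_mul_self, tensorMat_one]

theorem pauliWord_commute {n : ℕ} {w v : Fin n → Pauli}
    (h : Disjoint (wordQubits w) (wordQubits v)) : Commute (pauliWord w) (pauliWord v) := by
  rw [Commute, SemiconjBy, pauliWord_eq_tensorMat, pauliWord_eq_tensorMat, tensorMat_mul,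
    tensorMat_mul]
  congr 1
  funext q
  by_cases hw : w q = Pauli.I
  · simp [hw, Pauli.mat]
  · have hv : v q = Pauli.I := by
      by_contra hv
      exact Set.disjoint_left.1 h (show q ∈ wordQubits w from hw) hv
    simp [hv, Pauli.mat]

theorem star_dotProduct_mulVec {n : ℕ} (M : Matrix (Bits n) (Bits n) ℂ) (v w : Bits n → ℂ) :
    star v ⬝ᵥ (M *ᵥ w) = star (Mᴴ *ᵥ v) ⬝ᵥ w := by
  rw [Matrix.star_mulVec, Matrix.conjTranspose_conjTranspose, Matrix.dotProduct_mulVec]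

theorem star_dotProduct_self_mulVec {n : ℕ} {M : Matrix (Bits n) (Bits n) ℂ} (hM : Mᴴ * M = 1)
    (v : Bits n → ℂ) : star (M *ᵥ v) ⬝ᵥ (M *ᵥ v) = star v ⬝ᵥ v := by
  rw [star_dotProduct_mulVec, Matrix.mulVec_mulVec, hM, Matrix.one_mulVec]

namespace PauliExpansion

variable {n : ℕ}

theorem term_isHermitian (A : PauliExpansion n) (i : Fin A.card) : (A.term i).IsHermitian := by
  rw [Matrix.IsHermitian, term, Matrix.conjTranspose_smul, pauliWord_isHermitian]
  simp

theorem term_mul_self (A : PauliExpansion n) (i : Fin A.card) : A.term i * A.term i = 1 := by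
  rw [term, smul_mul_smul_comm, pauliWord_mul_self]
  rcases Int.units_eq_one_or (A.sign i) with h | h <;> simp [h]

theorem term_conjTranspose_mul (A : PauliExpansion n) (i : Fin A.card) :
    (A.term i)ᴴ * A.term i = 1 := by
  rw [A.term_isHermitian i, A.term_mul_self]

theorem op_isHermitian (A : PauliExpansion n) : A.op.IsHermitian := by
  rw [Matrix.IsHermitian, op, Matrix.conjTranspose_sum]
  refine Finset.sum_congr rfl fun i _ => ?_
  rw [Matrix.conjTranspose_smul, A.term_isHermitian i]
  simp

theorem op_commute (A : PauliExpansion n) {M : Matrix (Bits n) (Bits n) ℂ}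
    (h : ∀ i, Commute M (pauliWord (A.word i))) : Commute M A.op := by
  refine Commute.sum_right _ _ _ fun i _ => ?_
  exact ((h i).smul_right _).smul_right _

end PauliExpansion

/-- `M` acts only on the qubits in `S`, in the sense that it commutes with every Pauli product
which acts trivially on `S`. -/
def ActsOn {n : ℕ} (S : Set (Fin n)) (M : Matrix (Bits n) (Bits n) ℂ) : Prop :=
  ∀ w : Fin n → Pauli, Disjoint S (wordQubits w) → Commute M (pauliWord w)

namespace Parameterization

variable {n p : ℕ} (Θ : Parameterization n p) (H : PauliExpansion n)

/-! ### Pulses and the light cone of a generator term -/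

theorem pulse_conjTranspose_mul (θ : Fin p → ℝ) (j : Fin p) :
    (Θ.pulse θ j)ᴴ * Θ.pulse θ j = 1 := by
  rw [pulse, ← Matrix.exp_conjTranspose, Matrix.conjTranspose_smul, (Θ.gen j).op_isHermitian,
    ← Matrix.exp_add_of_commute _ _ (((Commute.refl _).smul_right _).smul_left _), ← add_smul]
  have : star (-(Complex.I * (θ j : ℂ) / 2)) + -(Complex.I * (θ j : ℂ) / 2) = 0 := by
    simp [Complex.conj_ofReal, neg_div]
  rw [this, zero_smul, NormedSpace.exp_zero]

theorem pulse_mul_conjTranspose (θ : Fin p → ℝ) (j : Fin p) :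
    Θ.pulse θ j * (Θ.pulse θ j)ᴴ = 1 :=
  mul_eq_one_comm.1 (Θ.pulse_conjTranspose_mul θ j)

theorem pulse_commute (θ : Fin p → ℝ) (j : Fin p) {M : Matrix (Bits n) (Bits n) ℂ}
    (h : ∀ i, Commute M (pauliWord ((Θ.gen j).word i))) : Commute M (Θ.pulse θ j) := by
  open scoped Matrix.Norms.Operator in
  exact (((Θ.gen j).op_commute h).smul_right _).exp_right

theorem evolve_nil (θ : Fin p → ℝ) : Θ.evolve θ [] = 1 := rfl

theorem evolve_cons (θ : Fin p → ℝ) (i : Fin p) (l : List (Fin p)) :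
    Θ.evolve θ (i :: l) = Θ.evolve θ l * Θ.pulse θ i := by
  simp [evolve]

theorem evolve_append (θ : Fin p → ℝ) (l l' : List (Fin p)) :
    Θ.evolve θ (l ++ l') = Θ.evolve θ l' * Θ.evolve θ l := by
  simp [evolve]

theorem evolve_conjTranspose_mul (θ : Fin p → ℝ) (l : List (Fin p)) :
    (Θ.evolve θ l)ᴴ * Θ.evolve θ l = 1 := by
  induction l with
  | nil => simp [evolve_nil]
  | cons i l ih =>
    rw [evolve_cons, Matrix.conjTranspose_mul, Matrix.mul_assoc,
      ← Matrix.mul_assoc (Θ.evolve θ l)ᴴ, ih, Matrix.one_mul, pulse_conjTranspose_mul]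

open Classical in
/-- The light cone argument: conjugation with a list of pulses spreads an operator at most over the
qubits collected by the greedy procedure. A pulse away from the qubits collected so far commutes
with the conjugated operator and cancels. -/
theorem actsOn_conj_evolve (θ : Fin p → ℝ) (l : List (Fin p)) (S : Set (Fin n))
    (M : Matrix (Bits n) (Bits n) ℂ) (hM : ActsOn S M) :
    ActsOn (l.foldl (fun S i => if Disjoint (Θ.gen i).qubits S then S
      else S ∪ (Θ.gen i).qubits) S) (Θ.evolve θ l * M * (Θ.evolve θ l)ᴴ) := by
  induction l generalizing S M with
  | nil => simpa [evolve_nil] using hM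
  | cons i l ih =>
    have e : Θ.evolve θ (i :: l) * M * (Θ.evolve θ (i :: l))ᴴ
        = Θ.evolve θ l * (Θ.pulse θ i * M * (Θ.pulse θ i)ᴴ) * (Θ.evolve θ l)ᴴ := by
      simp only [evolve_cons, Matrix.conjTranspose_mul, Matrix.mul_assoc]
    rw [e, List.foldl_cons]
    apply ih
    have hsub : ∀ k, wordQubits ((Θ.gen i).word k) ⊆ (Θ.gen i).qubits := fun k =>
      Set.subset_iUnion (fun k => wordQubits ((Θ.gen i).word k)) k
    split_ifs with hd
    · have hc : Commute M (Θ.pulse θ i) := Θ.pulse_commute θ i fun k =>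
        hM _ (hd.symm.mono_right (hsub k))
      rwa [← hc.eq, Matrix.mul_assoc, pulse_mul_conjTranspose, Matrix.mul_one]
    · intro w hw
      rw [Set.disjoint_union_left] at hw
      have hp : Commute (pauliWord w) (Θ.pulse θ i) := Θ.pulse_commute θ i fun k =>
        pauliWord_commute (hw.2.symm.mono_right (hsub k))
      have hp' : Commute (pauliWord w) (Θ.pulse θ i)ᴴ := by
        have := congrArg Matrix.conjTranspose hp.eq
        rw [Matrix.conjTranspose_mul, Matrix.conjTranspose_mul, pauliWord_isHermitian] at this
        exact this.symm
      exact ((hp.mul_right (hM w hw.1).symm).mul_right hp').symm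

theorem actsOn_term (j : Fin p) (k : Fin (Θ.gen j).card) :
    ActsOn (wordQubits ((Θ.gen j).word k)) ((Θ.gen j).term k) := fun _ hw =>
  (pauliWord_commute hw).smul_left _

/-! ### The gradient of the objective and the oracle -/

/-- `P_l U_{(j+1):p} Q_k^{(j)} U_{1:j} |Ψ⟩`, the branch of the Hadamard test that is interfered with
the trial state. -/
noncomputable def testState (θ : Fin p → ℝ) (j : Fin p) (k : Fin (Θ.gen j).card)
    (l : Fin H.card) : Bits n → ℂ :=
  H.term l *ᵥ (Θ.evolve θ (after j) *ᵥ ((Θ.gen j).term k *ᵥ (Θ.evolve θ (upTo j) *ᵥ Θ.init)))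

/-- The pulse `j` is the last one of `1, …, j`, and `1, …, p` splits into `1, …, j` and
`j + 1, …, p`. -/
theorem exists_upTo_eq (j : Fin p) : ∃ l : List (Fin p), j ∉ l ∧ j ∉ after j ∧
    upTo j = l ++ [j] ∧ List.finRange p = upTo j ++ after j := by
  obtain ⟨l₁, l₂, h⟩ := List.append_of_mem (List.mem_finRange j)
  have hs : List.Pairwise (· < ·) (l₁ ++ j :: l₂) := h ▸ List.pairwise_lt_finRange p
  rw [List.pairwise_append, List.pairwise_cons] at hs
  have h₁ : ∀ a ∈ l₁, a < j := fun a ha => hs.2.2 a ha j (by simp)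
  have h₂ : ∀ a ∈ l₂, j < a := hs.2.1.1
  have hu : upTo j = l₁ ++ [j] := by
    rw [upTo, h, List.filter_append, List.filter_cons, List.filter_eq_self.2,
      List.filter_eq_nil_iff.2]
    · simp
    · intro a ha; simpa using h₂ a ha
    · intro a ha; simpa using (h₁ a ha).le
  have ha : after j = l₂ := by
    rw [after, h, List.filter_append, List.filter_cons, List.filter_eq_nil_iff.2,
      List.filter_eq_self.2]
    · simp
    · intro a ha; simpa using h₂ a ha
    · intro a ha; simpa using (h₁ a ha).le
  refine ⟨l₁, fun hj => (h₁ j hj).false, ?_, hu, ?_⟩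
  · rw [ha]; exact fun hj => (h₂ j hj).false
  · rw [hu, ha, h]; simp

theorem evolve_finRange (θ : Fin p → ℝ) (j : Fin p) :
    Θ.evolve θ (List.finRange p) = Θ.evolve θ (after j) * Θ.evolve θ (upTo j) := by
  obtain ⟨l, -, -, -, h⟩ := exists_upTo_eq j
  rw [h, evolve_append]

theorem evolve_congr {θ θ' : Fin p → ℝ} {l : List (Fin p)} (h : ∀ i ∈ l, θ i = θ' i) :
    Θ.evolve θ l = Θ.evolve θ' l := by
  induction l with
  | nil => rfl
  | cons i l ih =>
    rw [evolve_cons, evolve_cons, ih fun k hk => h k (by simp [hk]), pulse, pulse, h i (by simp)]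

/-- Shifting `θ_j` by `t` inserts the one-parameter group of `A_j` behind the pulse `j`. -/
theorem evolve_update (θ : Fin p → ℝ) (j : Fin p) (t : ℝ) :
    Θ.evolve (θ + t • Pi.single j 1) (List.finRange p) =
      Θ.evolve θ (after j) * (NormedSpace.exp ((t : ℂ) • (-(Complex.I / 2)) • (Θ.gen j).op) *
        Θ.evolve θ (upTo j)) := by
  obtain ⟨l, hl, ha, hu, -⟩ := exists_upTo_eq j
  have hne : ∀ i, i ≠ j → (θ + t • (Pi.single j 1 : Fin p → ℝ)) i = θ i := fun i hi => by
    simp [hi]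
  rw [evolve_finRange _ _ j, Θ.evolve_congr (l := after j) (θ' := θ)
    fun i hi => hne i fun e => ha (e ▸ hi)]
  congr 1
  rw [hu, evolve_append, evolve_append, evolve_cons, evolve_cons, evolve_nil, evolve_nil,
    Matrix.one_mul, Matrix.one_mul, ← Matrix.mul_assoc,
    Θ.evolve_congr (l := l) (θ' := θ) fun i hi => hne i fun e => hl (e ▸ hi)]
  congr 1
  rw [pulse, pulse, smul_smul, ← Matrix.exp_add_of_commute _ _
    (((Commute.refl _).smul_right _).smul_left _), ← add_smul]
  congr 2
  simp
  ring

open scoped Matrix.Norms.Operator in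
theorem differentiable_evolve (l : List (Fin p)) (a b : Bits n) :
    Differentiable ℝ fun θ => Θ.evolve θ l a b := by
  induction l generalizing a b with
  | nil => simp [evolve_nil]
  | cons i l ih =>
    have hp : ∀ a b, Differentiable ℝ fun θ : Fin p → ℝ => Θ.pulse θ i a b := by
      intro a b
      have h1 : Differentiable ℝ fun t : ℝ =>
          NormedSpace.exp (t • (-(Complex.I / 2)) • (Θ.gen i).op) := fun t =>
        (hasDerivAt_exp_smul_const (𝕂 := ℝ) _ t).differentiableAt
      have h2 : Differentiable ℝ fun θ : Fin p → ℝ =>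
          NormedSpace.exp (θ i • (-(Complex.I / 2)) • (Θ.gen i).op) :=
        h1.comp (differentiable_apply i)
      have h3 : (fun θ : Fin p → ℝ => Θ.pulse θ i a b) = fun θ : Fin p → ℝ =>
          Matrix.entryLinearMap ℝ ℂ a b
            (NormedSpace.exp (θ i • (-(Complex.I / 2)) • (Θ.gen i).op)) := by
        funext θ
        have hc : -(Complex.I * (θ i : ℂ) / 2) = (θ i : ℂ) * -(Complex.I / 2) := by ring
        rw [pulse, hc, ← smul_smul, Complex.coe_smul]
        rfl
      rw [h3]
      exact (LinearMap.toContinuousLinearMap (Matrix.entryLinearMap ℝ ℂ a b)).differentiable.comp h2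
    simp only [evolve_cons, Matrix.mul_apply]
    exact Differentiable.fun_sum fun c _ => (ih a c).mul (hp c b)

theorem differentiable_objective : Differentiable ℝ (Θ.objective H) := by
  have hs : ∀ b, Differentiable ℝ fun θ => Θ.state θ b := fun b => by
    simp only [state, Matrix.mulVec, dotProduct]
    exact Differentiable.fun_sum fun c _ => (Θ.differentiable_evolve _ b c).mul_const _
  have : Differentiable ℝ fun θ => star (Θ.state θ) ⬝ᵥ (H.op *ᵥ Θ.state θ) := by
    simp only [Matrix.mulVec, dotProduct, Pi.star_apply]
    exact Differentiable.fun_sum fun b _ => (hs b).star.mul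
      (Differentiable.fun_sum fun c _ => (hs c).const_mul _)
  exact Complex.reCLM.differentiable.comp this

theorem star_dotProduct_init : star Θ.init ⬝ᵥ Θ.init = 1 := by
  have : star Θ.init ⬝ᵥ Θ.init = ((∑ b, ‖Θ.init b‖ ^ 2 : ℝ) : ℂ) := by
    simp [dotProduct, Complex.conj_mul']
  rw [this, Θ.init_norm, Complex.ofReal_one]

theorem star_dotProduct_state (θ : Fin p → ℝ) : star (Θ.state θ) ⬝ᵥ Θ.state θ = 1 := by
  rw [state, star_dotProduct_self_mulVec (Θ.evolve_conjTranspose_mul θ _), star_dotProduct_init]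

theorem star_dotProduct_testState (θ : Fin p → ℝ) (j : Fin p) (k : Fin (Θ.gen j).card)
    (l : Fin H.card) : star (Θ.testState H θ j k l) ⬝ᵥ Θ.testState H θ j k l = 1 := by
  rw [testState, star_dotProduct_self_mulVec (H.term_conjTranspose_mul l),
    star_dotProduct_self_mulVec (Θ.evolve_conjTranspose_mul θ _),
    star_dotProduct_self_mulVec ((Θ.gen j).term_conjTranspose_mul k),
    star_dotProduct_self_mulVec (Θ.evolve_conjTranspose_mul θ _), star_dotProduct_init]

/-- Differentiating the pulse `j` inserts `-i A_j / 2` behind it, and the two conjugate terms of the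
product rule add up to the imaginary part of an overlap, which is linear in `A_j` and `H`. -/
theorem hasLineDerivAt_objective (θ : Fin p → ℝ) (j : Fin p) :
    HasLineDerivAt ℝ (Θ.objective H)
      (∑ k, ∑ l, (Θ.gen j).coeff k * H.coeff l *
        (star (Θ.state θ) ⬝ᵥ Θ.testState H θ j k l).im) θ (Pi.single j 1) := by
  set χ : Bits n → ℂ :=
    Θ.evolve θ (after j) *ᵥ ((Θ.gen j).op *ᵥ (Θ.evolve θ (upTo j) *ᵥ Θ.init)) with hχ
  set φ : ℝ → Bits n → ℂ := fun t => Θ.state (θ + t • Pi.single j 1) with hφ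
  have hφ0 : φ 0 = Θ.state θ := by simp [hφ]
  have hder : ∀ b, HasDerivAt (fun t => φ t b) (-(Complex.I / 2) * χ b) 0 := by
    open scoped Matrix.Norms.Operator in
    have h1 : HasDerivAt (fun t : ℝ => NormedSpace.exp (t • (-(Complex.I / 2)) • (Θ.gen j).op))
        ((-(Complex.I / 2)) • (Θ.gen j).op) 0 := by
      have h := hasDerivAt_exp_smul_const (𝕂 := ℝ) ((-(Complex.I / 2)) • (Θ.gen j).op) 0
      rw [zero_smul, NormedSpace.exp_zero, one_mul] at h
      exact h
    intro b
    let L : Matrix (Bits n) (Bits n) ℂ →ₗ[ℝ] ℂ :=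
      { toFun := fun M => (Θ.evolve θ (after j) *ᵥ (M *ᵥ (Θ.evolve θ (upTo j) *ᵥ Θ.init))) b
        map_add' := fun M N => by rw [Matrix.add_mulVec, Matrix.mulVec_add, Pi.add_apply]
        map_smul' := fun c M => by
          rw [Matrix.smul_mulVec, Matrix.mulVec_smul, Pi.smul_apply, RingHom.id_apply] }
    have h2 := (LinearMap.toContinuousLinearMap L).hasFDerivAt.comp_hasDerivAt (0 : ℝ) h1
    have e1 : (fun t => φ t b) = (LinearMap.toContinuousLinearMap L) ∘
        fun t : ℝ => NormedSpace.exp (t • (-(Complex.I / 2)) • (Θ.gen j).op) := by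
      funext t
      simp only [hφ, state, evolve_update, Complex.coe_smul]
      simp [L, Matrix.mulVec_mulVec]
    have e2 : LinearMap.toContinuousLinearMap L ((-(Complex.I / 2)) • (Θ.gen j).op)
        = -(Complex.I / 2) * χ b := by
      change (Θ.evolve θ (after j) *ᵥ (((-(Complex.I / 2)) • (Θ.gen j).op) *ᵥ
        (Θ.evolve θ (upTo j) *ᵥ Θ.init))) b = _
      rw [Matrix.smul_mulVec, Matrix.mulVec_smul, Pi.smul_apply, smul_eq_mul]
    rw [e1, ← e2]
    exact h2
  have hobj : HasDerivAt (fun t => star (φ t) ⬝ᵥ (H.op *ᵥ φ t))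
      (star ((-(Complex.I / 2)) • χ) ⬝ᵥ (H.op *ᵥ φ 0) +
        star (φ 0) ⬝ᵥ (H.op *ᵥ ((-(Complex.I / 2)) • χ))) 0 := by
    simp only [Matrix.mulVec, dotProduct, Pi.star_apply, ← Finset.sum_add_distrib, Pi.smul_apply,
      smul_eq_mul]
    exact HasDerivAt.fun_sum fun b _ => (hder b).star.mul
      (HasDerivAt.fun_sum fun c _ => (hder c).const_mul _)
  have hre := Complex.reCLM.hasFDerivAt.comp_hasDerivAt (0 : ℝ) hobj
  have hsum : star (φ 0) ⬝ᵥ (H.op *ᵥ χ) = ∑ k, ∑ l, ((Θ.gen j).coeff k : ℂ) * H.coeff l *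
      (star (Θ.state θ) ⬝ᵥ Θ.testState H θ j k l) := by
    simp only [hφ0, hχ, testState, PauliExpansion.op, Matrix.sum_mulVec, Matrix.mulVec_sum,
      Matrix.smul_mulVec, Matrix.mulVec_smul, dotProduct_sum, dotProduct_smul, smul_eq_mul,
      Finset.mul_sum]
    refine Finset.sum_congr rfl fun k _ => Finset.sum_congr rfl fun l _ => ?_
    ring
  have hconj : star ((-(Complex.I / 2)) • χ) ⬝ᵥ (H.op *ᵥ φ 0) =
      star (star (φ 0) ⬝ᵥ (H.op *ᵥ ((-(Complex.I / 2)) • χ))) := by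
    rw [star_dotProduct_mulVec, H.op_isHermitian, ← Matrix.star_dotProduct]
  have hval : Complex.reCLM (star ((-(Complex.I / 2)) • χ) ⬝ᵥ (H.op *ᵥ φ 0) +
        star (φ 0) ⬝ᵥ (H.op *ᵥ ((-(Complex.I / 2)) • χ))) = ∑ k, ∑ l,
        (Θ.gen j).coeff k * H.coeff l * (star (Θ.state θ) ⬝ᵥ Θ.testState H θ j k l).im := by
    have him : (star (φ 0) ⬝ᵥ (H.op *ᵥ χ)).im = ∑ k, ∑ l,
        (Θ.gen j).coeff k * H.coeff l * (star (Θ.state θ) ⬝ᵥ Θ.testState H θ j k l).im := by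
      rw [hsum, Complex.im_sum]
      refine Finset.sum_congr rfl fun k _ => ?_
      rw [Complex.im_sum]
      refine Finset.sum_congr rfl fun l _ => ?_
      rw [← Complex.ofReal_mul, Complex.im_ofReal_mul]
    rw [hconj, Matrix.mulVec_smul, dotProduct_smul, ← him]
    simp
    ring
  rw [← hval]
  exact hre

/-- The bias of the `±1` outcome of the Hadamard test is the imaginary part of the overlap of the
trial state with the test state. -/
theorem hadamardTest_eq (θ : Fin p → ℝ) (j : Fin p) (k : Fin (Θ.gen j).card)
    (l : Fin H.card) (s : Bool) : Θ.hadamardTest H θ j k l s =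
      (1 + (if s then 1 else -1) * (star (Θ.state θ) ⬝ᵥ Θ.testState H θ j k l).im) / 2 := by
  have e0 : (fun b => Θ.init b / (Real.sqrt 2 : ℂ)) = ((Real.sqrt 2 : ℂ)⁻¹) • Θ.init := by
    funext b; simp [div_eq_inv_mul]
  have hb : ∀ b, applyControlled (H.term l) (applyB (Θ.evolve θ (after j))
      (applyControlled ((Θ.gen j).term k) (applyB (Θ.evolve θ (upTo j))
        (fun _ b => Θ.init b / (Real.sqrt 2 : ℂ))))) 0 b
      = (Real.sqrt 2 : ℂ)⁻¹ * Θ.state θ b := by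
    intro b
    simp only [applyControlled, applyB, e0]
    simp [Matrix.mulVec_smul, state, evolve_finRange Θ θ j]
  have hb' : ∀ b, applyControlled (H.term l) (applyB (Θ.evolve θ (after j))
      (applyControlled ((Θ.gen j).term k) (applyB (Θ.evolve θ (upTo j))
        (fun _ b => Θ.init b / (Real.sqrt 2 : ℂ))))) 1 b
      = (Real.sqrt 2 : ℂ)⁻¹ * Θ.testState H θ j k l b := by
    intro b
    simp only [applyControlled, applyB, e0]
    simp [Matrix.mulVec_smul, testState]
  have hn : ∀ v : Bits n → ℂ, star v ⬝ᵥ v = 1 → ∑ b, ((v b).re ^ 2 + (v b).im ^ 2) = 1 := by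
    intro v hv
    have := congrArg Complex.re hv
    simp only [dotProduct, Complex.re_sum, Pi.star_apply, Complex.one_re] at this
    rw [← this]
    refine Finset.sum_congr rfl fun b _ => ?_
    simp; ring
  have h2 : ((Real.sqrt 2)⁻¹ * (Real.sqrt 2)⁻¹ : ℝ) = 1 / 2 := by
    rw [← mul_inv, Real.mul_self_sqrt (by norm_num)]; norm_num
  have key : ∀ (σ : ℝ) (x y : ℂ), σ ^ 2 = 1 →
      ‖((Real.sqrt 2 : ℂ)⁻¹ * x - (σ : ℂ) * Complex.I * ((Real.sqrt 2 : ℂ)⁻¹ * y)) /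
        (Real.sqrt 2 : ℂ)‖ ^ 2
      = (x.re ^ 2 + x.im ^ 2) / 4 + (y.re ^ 2 + y.im ^ 2) / 4 + σ / 2 * (star x * y).im := by
    intro σ x y hσ
    have : ((Real.sqrt 2 : ℂ)⁻¹ * x - (σ : ℂ) * Complex.I * ((Real.sqrt 2 : ℂ)⁻¹ * y)) /
        (Real.sqrt 2 : ℂ) = ((1 / 2 : ℝ) : ℂ) * (x - σ * Complex.I * y) := by
      rw [← h2]; push_cast; field_simp
    rw [this, Complex.sq_norm, Complex.normSq_apply]
    simp
    linear_combination (y.re ^ 2 + y.im ^ 2) / 4 * hσ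
  have hsplit : ∀ σ : ℝ, σ ^ 2 = 1 → ∑ b, ‖((Real.sqrt 2 : ℂ)⁻¹ * Θ.state θ b - (σ : ℂ) *
      Complex.I * ((Real.sqrt 2 : ℂ)⁻¹ * Θ.testState H θ j k l b)) / (Real.sqrt 2 : ℂ)‖ ^ 2
      = (1 + σ * (star (Θ.state θ) ⬝ᵥ Θ.testState H θ j k l).im) / 2 := by
    intro σ hσ
    rw [Finset.sum_congr rfl fun b _ => key σ _ _ hσ, Finset.sum_add_distrib,
      Finset.sum_add_distrib, ← Finset.sum_div, ← Finset.sum_div, ← Finset.mul_sum,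
      hn _ (Θ.star_dotProduct_state θ), hn _ (Θ.star_dotProduct_testState H θ j k l),
      dotProduct, Complex.im_sum]
    simp only [Pi.star_apply]
    ring
  rw [hadamardTest, measureY]
  simp only [hb, hb']
  cases s
  · simpa using hsplit (-1) (by norm_num)
  · simpa using hsplit 1 (by norm_num)

theorem hadamardTest_nonneg (θ : Fin p → ℝ) (j : Fin p) (k : Fin (Θ.gen j).card)
    (l : Fin H.card) (s : Bool) : 0 ≤ Θ.hadamardTest H θ j k l s :=
  Finset.sum_nonneg fun _ _ => by positivity

/-- If the light cone of `Q_k^{(j)}` avoids the qubits of `P_l`, then `P_l` commutes with the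
conjugated term, their product is Hermitian, and the expectation is real. -/
theorem im_dotProduct_testState_eq_zero (θ : Fin p → ℝ) (j : Fin p) (k : Fin (Θ.gen j).card)
    (l : Fin H.card) (h : Disjoint (Θ.cone j k) (wordQubits (H.word l))) :
    (star (Θ.state θ) ⬝ᵥ Θ.testState H θ j k l).im = 0 := by
  set E := Θ.evolve θ (after j)
  set W := E * (Θ.gen j).term k * Eᴴ with hW
  have hc : Commute W (H.term l) :=
    (Θ.actsOn_conj_evolve θ (after j) _ _ (Θ.actsOn_term j k) _ h).smul_right _
  have hWh : Wᴴ = W := by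
    rw [hW, Matrix.conjTranspose_mul, Matrix.conjTranspose_mul, Matrix.conjTranspose_conjTranspose,
      (Θ.gen j).term_isHermitian k, Matrix.mul_assoc]
  have ht : Θ.testState H θ j k l = (H.term l * W) *ᵥ Θ.state θ := by
    rw [testState, state, evolve_finRange Θ θ j]
    simp only [Matrix.mulVec_mulVec, hW]
    congr 1
    have : Eᴴ * E = 1 := Θ.evolve_conjTranspose_mul θ _
    simp only [Matrix.mul_assoc]
    rw [← Matrix.mul_assoc Eᴴ E, this, Matrix.one_mul]
  have hh : (H.term l * W)ᴴ = H.term l * W := by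
    rw [Matrix.conjTranspose_mul, hWh, H.term_isHermitian l, hc.eq]
  have hs : star (star (Θ.state θ) ⬝ᵥ Θ.testState H θ j k l)
      = star (Θ.state θ) ⬝ᵥ Θ.testState H θ j k l := by
    rw [ht]
    conv_rhs => rw [star_dotProduct_mulVec, hh]
    exact (Matrix.star_dotProduct _ _).symm
  exact Complex.conj_eq_iff_im.1 hs

theorem gammaCoeff_nonneg (j : Fin p) (k : Fin (Θ.gen j).card) (l : Fin H.card) :
    0 ≤ Θ.gammaCoeff H j k l := by
  rw [gammaCoeff]
  split_ifs
  · exact le_rfl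
  · exact mul_nonneg ((Θ.gen j).coeff_pos k).le (H.coeff_pos l).le

theorem Gamma_nonneg (j : Fin p) : 0 ≤ Θ.Gamma H j :=
  Finset.sum_nonneg fun k _ => Finset.sum_nonneg fun l _ => Θ.gammaCoeff_nonneg H j k l

/-- The partial derivatives are weighted by the coefficients `γ` only: the pairs removed by the light
cone contribute nothing. -/
theorem fderiv_objective_single (θ : Fin p → ℝ) (j : Fin p) :
    fderiv ℝ (Θ.objective H) θ (Pi.single j 1) = ∑ k, ∑ l, Θ.gammaCoeff H j k l *
      (star (Θ.state θ) ⬝ᵥ Θ.testState H θ j k l).im := by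
  have h1 := ((Θ.differentiable_objective H) θ).hasFDerivAt.hasLineDerivAt (Pi.single j 1)
  rw [h1.unique (Θ.hasLineDerivAt_objective H θ j)]
  refine Finset.sum_congr rfl fun k _ => Finset.sum_congr rfl fun l _ => ?_
  rw [gammaCoeff]
  split_ifs with h
  · rw [Θ.im_dotProduct_testState_eq_zero H θ j k l h, mul_zero, zero_mul]
  · rfl

theorem oracleProb_nonneg (θ : Fin p → ℝ) (j : Fin p) (s : Bool) :
    0 ≤ Θ.oracleProb H θ j s := by
  rw [oracleProb]
  split_ifs
  · norm_num
  · exact Finset.sum_nonneg fun k _ => Finset.sum_nonneg fun l _ => mul_nonneg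
      (div_nonneg (Θ.gammaCoeff_nonneg H j k l) (Θ.Gamma_nonneg H j))
      (Θ.hadamardTest_nonneg H θ j k l s)

theorem oracleProb_add (θ : Fin p → ℝ) (j : Fin p) :
    Θ.oracleProb H θ j true + Θ.oracleProb H θ j false = 1 := by
  rw [oracleProb, oracleProb]
  split_ifs with h
  · norm_num
  · have hadd : ∀ k l, Θ.hadamardTest H θ j k l true + Θ.hadamardTest H θ j k l false = 1 :=
      fun k l => by
        simp only [hadamardTest_eq, if_true, Bool.false_eq_true, if_false]
        ring
    simp only [← Finset.sum_add_distrib, ← mul_add, hadd, mul_one, ← Finset.sum_div]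
    exact div_self h

/-- The oracle is an unbiased estimator of the partial derivative. -/
theorem oracleProb_sub (θ : Fin p → ℝ) (j : Fin p) :
    Θ.Gamma H j * (Θ.oracleProb H θ j true - Θ.oracleProb H θ j false) =
      fderiv ℝ (Θ.objective H) θ (Pi.single j 1) := by
  rw [fderiv_objective_single, oracleProb, oracleProb]
  split_ifs with h
  · have h0 : ∀ k l, Θ.gammaCoeff H j k l = 0 := fun k l => by
      have h1 := (Finset.sum_eq_zero_iff_of_nonneg fun k _ => Finset.sum_nonneg fun l _ =>
        Θ.gammaCoeff_nonneg H j k l).1 h k (Finset.mem_univ k)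
      exact (Finset.sum_eq_zero_iff_of_nonneg fun l _ =>
        Θ.gammaCoeff_nonneg H j k l).1 h1 l (Finset.mem_univ l)
    simp [h0]
  · simp only [← Finset.sum_sub_distrib, ← mul_sub, hadamardTest_eq, Finset.mul_sum]
    refine Finset.sum_congr rfl fun k _ => Finset.sum_congr rfl fun l _ => ?_
    rw [← mul_assoc, mul_div_cancel₀ _ h]
    simp only [if_true, Bool.false_eq_true, if_false]
    ring

end Parameterization

/-! ### Finite product laws and sub-Gaussian sampling -/

theorem sum_prod_eq_one {ι : Type*} [Fintype ι] [DecidableEq ι] {α : ι → Type*}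
    [∀ i, Fintype (α i)] (π : ∀ i, α i → ℝ) (hπ : ∀ i, ∑ v, π i v = 1) :
    ∑ o : ∀ i, α i, ∏ i, π i (o i) = 1 := by
  rw [← Fintype.prod_sum]
  exact Finset.prod_eq_one fun i _ => hπ i

/-- The marginal of a product law in one coordinate. -/
theorem sum_prod_mul_apply {ι : Type*} [Fintype ι] [DecidableEq ι] {α : ι → Type*}
    [∀ i, Fintype (α i)] (π : ∀ i, α i → ℝ) (hπ : ∀ i, ∑ v, π i v = 1) (j : ι) (h : α j → ℝ) :
    ∑ o : ∀ i, α i, (∏ i, π i (o i)) * h (o j) = ∑ v, π j v * h v := by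
  have e : ∀ o : ∀ i, α i, (∏ i, π i (o i)) * h (o j) =
      ∏ i, Function.update π j (fun v => π j v * h v) i (o i) := fun o => by
    rw [← Finset.mul_prod_erase _ _ (Finset.mem_univ j),
      ← Finset.mul_prod_erase _ _ (Finset.mem_univ j), Function.update_self, mul_right_comm]
    congr 1
    refine Finset.prod_congr rfl fun i hi => ?_
    rw [Function.update_of_ne (Finset.ne_of_mem_erase hi)]
  simp only [e]
  rw [← Fintype.prod_sum, ← Finset.mul_prod_erase _ _ (Finset.mem_univ j), Function.update_self,
    Finset.prod_eq_one, mul_one]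
  intro i hi
  rw [Function.update_of_ne (Finset.ne_of_mem_erase hi), hπ]

/-- Symmetrization: multiplying by the moment generating function of an independent copy leaves the
symmetric variable with values in `{-2, 0, 2}`. -/
theorem bernoulli_mgf_le {a b : ℝ} (ha : 0 ≤ a) (hb : 0 ≤ b) (hab : a + b = 1) (c : ℝ) :
    a * Real.exp c + b * Real.exp (-c) ≤ Real.exp (c * (a - b) + 2 * c ^ 2) := by
  have hconv : Real.exp (-(c * (a - b))) ≤ a * Real.exp (-c) + b * Real.exp c := by
    have := convexOn_exp.2 (Set.mem_univ (-c)) (Set.mem_univ c) ha hb hab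
    simp only [smul_eq_mul] at this
    rwa [show a * -c + b * c = -(c * (a - b)) by ring] at this
  have hcosh : Real.cosh (2 * c) ≤ Real.exp (2 * c ^ 2) := by
    refine (Real.cosh_le_exp_half_sq _).trans (Real.exp_le_exp.2 ?_)
    linarith [sq_nonneg c]
  have hprod : (a * Real.exp c + b * Real.exp (-c)) * (a * Real.exp (-c) + b * Real.exp c) ≤
      Real.cosh (2 * c) := by
    have h1 : Real.exp c * Real.exp (-c) = 1 := by rw [← Real.exp_add]; simp
    have h2 : Real.cosh (2 * c) = (Real.exp c ^ 2 + Real.exp (-c) ^ 2) / 2 := by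
      rw [Real.cosh_eq, ← Real.exp_nat_mul, ← Real.exp_nat_mul]
      norm_num
    have h3 : (0 : ℝ) ≤ (1 - 2 * (a * b)) := by nlinarith [sq_nonneg (a - b)]
    have h4 := mul_nonneg h3 (sub_nonneg.2 (Real.one_le_cosh (2 * c)))
    rw [h2] at h4 ⊢
    have hb' : b = 1 - a := by linarith
    subst hb'
    nlinarith
  have hpos : 0 ≤ a * Real.exp c + b * Real.exp (-c) := by positivity
  have := (mul_le_mul_of_nonneg_left hconv hpos).trans (hprod.trans hcosh)
  rw [Real.exp_neg (c * (a - b)), mul_inv_le_iff₀ (Real.exp_pos _), ← Real.exp_add] at this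
  rwa [add_comm (c * (a - b))]

/-- The moment generating function of a sum of independent identically distributed signs. -/
theorem sum_prod_mul_exp {N : ℕ} (π : Bool → ℝ) (x : Bool → ℝ) :
    ∑ v : Fin N → Bool, (∏ i, π (v i)) * Real.exp (∑ i, x (v i)) =
      (π true * Real.exp (x true) + π false * Real.exp (x false)) ^ N := by
  have : ∀ v : Fin N → Bool, (∏ i, π (v i)) * Real.exp (∑ i, x (v i)) =
      ∏ i, π (v i) * Real.exp (x (v i)) := fun v => by
    rw [Real.exp_sum, Finset.prod_mul_distrib]
  simp only [this]
  rw [← Fintype.prod_sum (fun (_ : Fin N) b => π b * Real.exp (x b))]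
  simp

section Batch

variable {p : ℕ} (G : Fin p → ℝ) (κ : ℝ) (π : Fin p → Bool → ℝ)

/-- The law of the signs received in one call of the gradient estimator, when the answers in
coordinate `j` are independent with law `π j`. -/
noncomputable def batchLaw (o : BatchOutcome G κ) : ℝ := ∏ j, ∏ i, π j (o j i)

variable {π}

theorem sum_batchLaw_mul_apply (hπ : ∀ j, π j true + π j false = 1) (j : Fin p)
    (h : (Fin (batchSize G κ j) → Bool) → ℝ) :
    ∑ o, batchLaw G κ π o * h (o j) = ∑ v, (∏ i, π j (v i)) * h v :=
  sum_prod_mul_apply (fun j (v : Fin (batchSize G κ j) → Bool) => ∏ i, π j (v i))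
    (fun j => sum_prod_eq_one (fun _ => π j) fun _ => by simpa using hπ j) j h

theorem sum_batchLaw (hπ : ∀ j, π j true + π j false = 1) : ∑ o, batchLaw G κ π o = 1 :=
  sum_prod_eq_one (fun j (v : Fin (batchSize G κ j) → Bool) => ∏ i, π j (v i))
    (fun j => sum_prod_eq_one (fun _ => π j) fun _ => by simpa using hπ j)

/-- The gradient estimate is unbiased. The average over no answers is the junk value `0 / 0 = 0`,
which is correct because of `hG`. -/
theorem sum_batchLaw_mul_gradEstimate (hπ : ∀ j, π j true + π j false = 1) (j : Fin p)
    (hG : batchSize G κ j = 0 → G j = 0) :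
    ∑ o, batchLaw G κ π o * gradEstimate G κ o j = G j * (π j true - π j false) := by
  have := sum_batchLaw_mul_apply G κ hπ j
    fun v => (∑ i, if v i then G j else -G j) / (batchSize G κ j : ℝ)
  refine (this.trans ?_)
  rcases Nat.eq_zero_or_pos (batchSize G κ j) with h0 | h0
  · simp [hG h0]
  · simp only [← mul_div_assoc, Finset.mul_sum]
    rw [← Finset.sum_div, Finset.sum_comm]
    have hi : ∀ i : Fin (batchSize G κ j), ∑ v : Fin (batchSize G κ j) → Bool,
        (∏ i, π j (v i)) * (if v i then G j else -G j) = G j * (π j true - π j false) := fun i => by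
      rw [sum_prod_mul_apply (fun _ : Fin (batchSize G κ j) => π j) (fun _ => by simpa using hπ j)
        i fun b => if b then G j else -G j]
      simp
      ring
    have hne : (batchSize G κ j : ℝ) ≠ 0 := by exact_mod_cast h0.ne'
    simp only [hi, Finset.sum_const, Finset.card_univ, Fintype.card_fin, nsmul_eq_mul]
    field_simp

theorem sum_batchLaw_mul_exp_le (h0 : ∀ j s, 0 ≤ π j s) (hπ : ∀ j, π j true + π j false = 1)
    (j : Fin p) (hG : batchSize G κ j = 0 → G j = 0) (η : ℝ) :
    ∑ o, batchLaw G κ π o * Real.exp (η * gradEstimate G κ o j) ≤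
      Real.exp (η * (G j * (π j true - π j false)) +
        2 * (η ^ 2 * (G j ^ 2 / batchSize G κ j))) := by
  have := sum_batchLaw_mul_apply G κ hπ j
    fun v => Real.exp (η * ((∑ i, if v i then G j else -G j) / (batchSize G κ j : ℝ)))
  refine (this.trans_le ?_)
  set N := batchSize G κ j with hN
  set c : ℝ := η * G j / N with hc
  have e : ∀ v : Fin N → Bool, η * ((∑ i, if v i then G j else -G j) / (N : ℝ)) =
      ∑ i, if v i then c else -c := fun v => by
    rw [Finset.sum_div, Finset.mul_sum]
    refine Finset.sum_congr rfl fun i _ => ?_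
    split_ifs <;> rw [hc] <;> ring
  simp only [e]
  rw [sum_prod_mul_exp (π j) fun b => if b then c else -c]
  simp only [if_true, Bool.false_eq_true, if_false]
  refine (pow_le_pow_left₀ (add_nonneg (mul_nonneg (h0 j _) (Real.exp_pos _).le)
    (mul_nonneg (h0 j _) (Real.exp_pos _).le))
    (bernoulli_mgf_le (h0 j true) (h0 j false) (hπ j) c) N).trans ?_
  rw [← Real.exp_nat_mul]
  refine Real.exp_le_exp.2 (le_of_eq ?_)
  rcases Nat.eq_zero_or_pos N with h | h
  · simp [hG h, h]
  · have hne : (N : ℝ) ≠ 0 := by exact_mod_cast h.ne'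
    rw [hc]
    field_simp

/-- The averaged answers are sub-Gaussian around the partial derivative `Γ_j (π_j(+) - π_j(-))`, hence
`cosh (η ĝ_j) - 1` is quadratically small in expectation, coordinate by coordinate and without a
factor `log p`. -/
theorem sum_batchLaw_mul_cosh_le (h0 : ∀ j s, 0 ≤ π j s) (hπ : ∀ j, π j true + π j false = 1)
    (j : Fin p) (hG : batchSize G κ j = 0 → G j = 0) {η V : ℝ}
    (hN : G j ^ 2 / batchSize G κ j ≤ V) (hd : (G j * (π j true - π j false)) ^ 2 ≤ V / 2)
    (hη : 9 / 4 * (η ^ 2 * V) ≤ 1) :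
    ∑ o, batchLaw G κ π o * (Real.cosh (η * gradEstimate G κ o j) - 1) ≤
      9 / 2 * (η ^ 2 * V) := by
  set d := G j * (π j true - π j false) with hdd
  have h1 := sum_batchLaw_mul_exp_le G κ h0 hπ j hG η
  have h2 := sum_batchLaw_mul_exp_le G κ h0 hπ j hG (-η)
  rw [← hdd] at h1 h2
  have hV : 0 ≤ V := le_trans (by positivity) hN
  have hη2 := sq_nonneg η
  have hX : η ^ 2 * (G j ^ 2 / batchSize G κ j) ≤ η ^ 2 * V := mul_le_mul_of_nonneg_left hN hη2
  have hD : (η * d) ^ 2 ≤ η ^ 2 * V / 2 := by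
    rw [mul_pow]; nlinarith [mul_le_mul_of_nonneg_left hd hη2]
  have hsum : ∑ o, batchLaw G κ π o * (Real.cosh (η * gradEstimate G κ o j) - 1) =
      (∑ o, batchLaw G κ π o * Real.exp (η * gradEstimate G κ o j) +
        ∑ o, batchLaw G κ π o * Real.exp (-η * gradEstimate G κ o j)) / 2 - 1 := by
    simp only [mul_sub, mul_one, Finset.sum_sub_distrib, sum_batchLaw G κ hπ]
    rw [← Finset.sum_add_distrib, Finset.sum_div]
    congr 1
    refine Finset.sum_congr rfl fun o _ => ?_
    rw [Real.cosh_eq, neg_mul]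
    ring
  have hexp : (Real.exp (η * d + 2 * (η ^ 2 * V)) + Real.exp (-η * d + 2 * (η ^ 2 * V))) / 2 ≤
      Real.exp (9 / 4 * (η ^ 2 * V)) := by
    have : (Real.exp (η * d + 2 * (η ^ 2 * V)) + Real.exp (-η * d + 2 * (η ^ 2 * V))) / 2 =
        Real.cosh (η * d) * Real.exp (2 * (η ^ 2 * V)) := by
      rw [Real.cosh_eq, Real.exp_add, Real.exp_add, neg_mul]; ring
    rw [this]
    refine (mul_le_mul_of_nonneg_right (Real.cosh_le_exp_half_sq _) (Real.exp_pos _).le).trans ?_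
    rw [← Real.exp_add]
    exact Real.exp_le_exp.2 (by linarith)
  have hu0 : 0 ≤ 9 / 4 * (η ^ 2 * V) := by positivity
  have hlin := (abs_le.1 (Real.abs_exp_sub_one_le (by rwa [abs_of_nonneg hu0]))).2
  rw [abs_of_nonneg hu0] at hlin
  have h1' := h1.trans (Real.exp_le_exp.2 (show _ ≤ η * d + 2 * (η ^ 2 * V) by linarith))
  have h2' := h2.trans (Real.exp_le_exp.2 (show _ ≤ -η * d + 2 * (η ^ 2 * V) by
    rw [neg_sq]; linarith))
  rw [hsum]
  linarith

end Batch

/-! ### Adapted processes on finite outcome trees -/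

/-- Resampling one coordinate uniformly preserves uniform sums. -/
theorem card_mul_sum_eq_sum_update {T : ℕ} {O : Type*} [Fintype O]
    (m : Fin T) (F : (Fin T → O) → ℝ) :
    (Fintype.card O : ℝ) * ∑ ω, F ω = ∑ ω : Fin T → O, ∑ o, F (Function.update ω m o) := by
  have h1 : ∑ x : (Fin T → O) × O, F (Function.update x.1 m x.2) =
      ∑ x : (Fin T → O) × O, F x.1 := by
    refine Finset.sum_nbij' (fun x => (Function.update x.1 m x.2, x.1 m))
      (fun x => (Function.update x.1 m x.2, x.1 m)) ?_ ?_ ?_ ?_ ?_ <;> simp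
  rw [← Fintype.sum_prod_type', h1, Fintype.sum_prod_type, Finset.mul_sum]
  simp

/-- If the conditional law `q t` of the `t`-th outcome depends only on the previous outcomes and `V`
decreases in conditional expectation, then its final expectation is at most its initial value. -/
theorem sum_prod_mul_le_of_supermartingale {T : ℕ} {O : Type*} [Fintype O] [Nonempty O]
    (q : Fin T → (Fin T → O) → O → ℝ) (q_nonneg : ∀ t ω o, 0 ≤ q t ω o)
    (hq : ∀ t ω ω', (∀ i < t, ω i = ω' i) → q t ω = q t ω')
    (V : ℕ → (Fin T → O) → ℝ) (v₀ : ℝ) (hV₀ : ∀ ω, V 0 ω ≤ v₀)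
    (hV : ∀ (t : Fin T) ω, ∑ o, q t ω o * V (t + 1) (Function.update ω t o) ≤ V t ω) :
    ∑ ω, (∏ t, q t ω (ω t)) * V T ω ≤ v₀ := by
  set c : ℝ := (Fintype.card O : ℝ) with hc
  have hcpos : 0 < c := by rw [hc]; exact_mod_cast Fintype.card_pos
  -- Uniform sums over all of `Fin T → O` count each prefix of length `m` with multiplicity
  -- `c ^ (T - m)`, which the factor `c ^ m` compensates.
  let P : ℕ → (Fin T → O) → ℝ := fun m ω => ∏ t with t.val < m, q t ω (ω t)
  have key : ∀ m ≤ T, c ^ m * ∑ ω, P m ω * V m ω ≤ c ^ T * v₀ := by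
    intro m
    induction m with
    | zero =>
      intro _
      have hcard : (Fintype.card (Fin T → O) : ℝ) = c ^ T := by simp [hc]
      have hP : ∀ ω, P 0 ω = 1 := fun ω => by simp [P]
      simp only [hP, one_mul, pow_zero]
      refine (Finset.sum_le_sum fun ω _ => hV₀ ω).trans ?_
      rw [Finset.sum_const, Finset.card_univ, nsmul_eq_mul, hcard]
    | succ m ih =>
      intro hm
      refine le_trans ?_ (ih (by omega))
      let t : Fin T := ⟨m, hm⟩
      rw [pow_succ, mul_assoc, hc, card_mul_sum_eq_sum_update t]
      refine mul_le_mul_of_nonneg_left (Finset.sum_le_sum fun ω _ => ?_) (pow_nonneg hcpos.le _)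
      have hPstep : ∀ o, P (m + 1) (Function.update ω t o) = P m ω * q t ω o := by
        intro o
        have hset : (Finset.univ.filter fun s : Fin T => s.val < m + 1) =
            insert t (Finset.univ.filter fun s : Fin T => s.val < m) := by
          ext s
          simp only [Finset.mem_filter, Finset.mem_univ, true_and, Finset.mem_insert, Fin.ext_iff, t]
          omega
        have hqs : ∀ s : Fin T, s ≤ t → q s (Function.update ω t o) = q s ω := fun s hs =>
          hq s _ _ fun i hi => Function.update_of_ne (hi.trans_le hs).ne _ _
        simp only [P, hset]
        rw [Finset.prod_insert (by simp [t]), hqs t le_rfl, Function.update_self, mul_comm]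
        congr 1
        refine Finset.prod_congr rfl fun s hs => ?_
        have hst : s < t := by simpa [Fin.lt_def, t] using hs
        rw [hqs s hst.le, Function.update_of_ne hst.ne]
      simp only [hPstep, mul_assoc]
      rw [← Finset.mul_sum]
      exact mul_le_mul_of_nonneg_left (hV t ω) (Finset.prod_nonneg fun s _ => q_nonneg _ _ _)
  have := key T le_rfl
  have hP : ∀ ω, P T ω = ∏ t, q t ω (ω t) := fun ω => by simp [P]
  simp only [hP] at this
  exact le_of_mul_le_mul_left this (pow_pos hcpos T)

/-! ### The hyperbolic entropy -/

/-- The hyperbolic entropy at scale `b`, the convex function with derivative `arsinh (y / b)`. It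
grows like `|y| log (|y| / b)`. -/
noncomputable def hypEntropy (b y : ℝ) : ℝ :=
  y * Real.arsinh (y / b) - b * √(1 + (y / b) ^ 2)

/-- The Bregman divergence of the hyperbolic entropy. -/
noncomputable def hypDiv (b y x : ℝ) : ℝ :=
  hypEntropy b y - hypEntropy b x - Real.arsinh (x / b) * (y - x)

theorem hasDerivAt_hypEntropy {b : ℝ} (hb : 0 < b) (y : ℝ) :
    HasDerivAt (hypEntropy b) (Real.arsinh (y / b)) y := by
  have h1 : HasDerivAt (fun y : ℝ => y / b) (1 / b) y := (hasDerivAt_id y).div_const b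
  have hpos : 0 < 1 + (y / b) ^ 2 := by positivity
  have h2 := (hasDerivAt_id y).mul h1.arsinh
  have h3 := (((h1.pow 2).const_add 1).sqrt hpos.ne').const_mul b
  refine (h2.sub h3).congr_deriv ?_
  have hs := (Real.sqrt_pos.2 hpos).ne'
  have hb' := hb.ne'
  change 1 * Real.arsinh (y / b) + y * ((√(1 + (y / b) ^ 2))⁻¹ * (1 / b)) -
    b * (2 * (y / b) ^ 1 * (1 / b) / (2 * √(1 + (y / b) ^ 2))) = _
  generalize √(1 + (y / b) ^ 2) = q at *
  rw [pow_one]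
  field_simp
  ring

theorem cosh_tangent_le (w v : ℝ) : Real.cosh w + (v - w) * Real.sinh w ≤ Real.cosh v := by
  have h1 := mul_le_mul_of_nonneg_left (Real.add_one_le_exp (v - w)) (Real.exp_pos w).le
  have h2 := mul_le_mul_of_nonneg_left (Real.add_one_le_exp (-v + w)) (Real.exp_pos (-w)).le
  rw [← Real.exp_add] at h1 h2
  rw [show w + (v - w) = v by ring] at h1
  rw [show -w + (-v + w) = -v by ring] at h2
  rw [Real.cosh_eq, Real.cosh_eq, Real.sinh_eq]
  linarith

theorem cosh_tangent_lt {w v : ℝ} (h : v ≠ w) :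
    Real.cosh w + (v - w) * Real.sinh w < Real.cosh v := by
  have h1 := mul_lt_mul_of_pos_left (Real.add_one_lt_exp (sub_ne_zero.2 h)) (Real.exp_pos w)
  have h2 := mul_le_mul_of_nonneg_left (Real.add_one_le_exp (-v + w)) (Real.exp_pos (-w)).le
  rw [← Real.exp_add] at h1 h2
  rw [show w + (v - w) = v by ring] at h1
  rw [show -w + (-v + w) = -v by ring] at h2
  rw [Real.cosh_eq, Real.cosh_eq, Real.sinh_eq]
  linarith

/-- In the dual coordinates `w = arsinh (y / b)` and `z = arsinh (x / b)`, the divergence is the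
Bregman divergence of `b cosh` with exchanged arguments. -/
theorem hypDiv_eq {b : ℝ} (hb : 0 < b) (y x : ℝ) :
    hypDiv b y x = b * (Real.cosh (Real.arsinh (x / b)) - (Real.cosh (Real.arsinh (y / b)) +
      (Real.arsinh (x / b) - Real.arsinh (y / b)) * Real.sinh (Real.arsinh (y / b)))) := by
  rw [hypDiv, hypEntropy, hypEntropy, Real.cosh_arsinh, Real.cosh_arsinh, Real.sinh_arsinh]
  field_simp
  ring

theorem hypDiv_nonneg {b : ℝ} (hb : 0 < b) (y x : ℝ) : 0 ≤ hypDiv b y x := by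
  rw [hypDiv_eq hb]
  exact mul_nonneg hb.le (sub_nonneg.2 (cosh_tangent_le _ _))

theorem hypDiv_pos {b : ℝ} (hb : 0 < b) {y x : ℝ} (h : x ≠ y) : 0 < hypDiv b y x := by
  rw [hypDiv_eq hb]
  refine mul_pos hb (sub_pos.2 (cosh_tangent_lt fun e => h ?_))
  have := Real.arsinh_injective e
  field_simp at this
  exact this

theorem abs_sinh_sub_self_le (s : ℝ) : |Real.sinh s - s| ≤ Real.cosh s - 1 := by
  have h1 := Real.add_one_le_exp s
  have h2 := Real.add_one_le_exp (-s)
  rw [Real.sinh_eq, Real.cosh_eq, abs_le]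
  constructor <;> linarith

/-- The Fenchel inequality for the hyperbolic entropy: the gain of one coordinate of a mirror step is
at most the dual divergence, whose second order part is the local norm `|x| + b`. -/
theorem mul_sub_sub_hypDiv_le {b : ℝ} (hb : 0 < b) (s x y : ℝ) :
    s * (x - y) - hypDiv b y x ≤ (2 * |x| + b) * (Real.cosh s - 1) := by
  rw [hypDiv_eq hb]
  set w := Real.arsinh (y / b) with hw
  set z := Real.arsinh (x / b) with hz
  have hy : y = b * Real.sinh w := by rw [hw, Real.sinh_arsinh]; field_simp
  have hx : x = b * Real.sinh z := by rw [hz, Real.sinh_arsinh]; field_simp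
  have ht := mul_le_mul_of_nonneg_left (cosh_tangent_le w (z - s)) hb.le
  rw [Real.cosh_sub] at ht
  have h1 := Real.one_le_cosh s
  have hcz : b * Real.cosh z ≤ |x| + b := by
    have h2 : Real.cosh z ≤ |Real.sinh z| + 1 := by
      have := Real.cosh_sq z
      nlinarith [Real.one_le_cosh z, abs_nonneg (Real.sinh z), sq_abs (Real.sinh z)]
    calc b * Real.cosh z ≤ b * (|Real.sinh z| + 1) := mul_le_mul_of_nonneg_left h2 hb.le
      _ = |x| + b := by rw [hx, abs_mul, abs_of_pos hb]; ring
  have h3 : -(x * (Real.sinh s - s)) ≤ |x| * (Real.cosh s - 1) :=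
    (neg_le_abs _).trans (by
      rw [abs_mul]; exact mul_le_mul_of_nonneg_left (abs_sinh_sub_self_le s) (abs_nonneg x))
  have h4 := mul_le_mul_of_nonneg_right hcz (sub_nonneg.2 h1)
  have h5 : s * (x - y) - b * (Real.cosh z - (Real.cosh w + (z - w) * Real.sinh w)) ≤
      b * Real.cosh z * (Real.cosh s - 1) - x * (Real.sinh s - s) := by
    rw [hx, hy]
    linarith
  linarith

theorem arsinh_le_log {x : ℝ} (hx : 0 ≤ x) : Real.arsinh x ≤ Real.log (1 + 2 * x) := by
  rw [Real.arsinh]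
  refine Real.log_le_log (by positivity) ?_
  have : √(1 + x ^ 2) ≤ 1 + x := Real.sqrt_le_iff.2 ⟨by positivity, by nlinarith⟩
  linarith

/-- Starting from the center, the divergence is almost linear in the distance. -/
theorem hypDiv_zero_le {b : ℝ} (hb : 0 < b) (y : ℝ) :
    hypDiv b y 0 ≤ |y| * Real.log (1 + 2 * (|y| / b)) := by
  have h1 : 1 ≤ √(1 + (y / b) ^ 2) := Real.one_le_sqrt.2 (by linarith [sq_nonneg (y / b)])
  have h2 : y * Real.arsinh (y / b) = |y| * Real.arsinh (|y| / b) := by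
    rcases abs_cases y with ⟨h, -⟩ | ⟨h, -⟩ <;> rw [h]
    rw [neg_div, Real.arsinh_neg]
    ring
  have h3 := mul_le_mul_of_nonneg_left (arsinh_le_log (div_nonneg (abs_nonneg y) hb.le))
    (abs_nonneg y)
  have h4 : hypDiv b y 0 = y * Real.arsinh (y / b) - b * (√(1 + (y / b) ^ 2) - 1) := by
    simp [hypDiv, hypEntropy]
    ring
  rw [h4, h2]
  nlinarith

/-- Summed over the coordinates, the divergence from the center costs only a factor `log p`, if the
scale of the entropy is `ρ / p`. -/
theorem sum_hypDiv_zero_le {p : ℕ} (hp : 0 < p) {ρ : ℝ} (hρ : 0 < ρ) (v : Fin p → ℝ) :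
    ∑ j, hypDiv (ρ / p) (v j) 0 ≤
      (∑ j, |v j|) * Real.log p + 2 * (∑ j, |v j|) ^ 2 / ρ := by
  set r := ∑ j, |v j| with hr
  have hr0 : 0 ≤ r := Finset.sum_nonneg fun _ _ => abs_nonneg _
  have hp' : (0 : ℝ) < p := by exact_mod_cast hp
  have hp1 : (1 : ℝ) ≤ p := by exact_mod_cast hp
  have hlog : ∀ j, Real.log (1 + 2 * (|v j| / (ρ / p))) ≤ Real.log p + 2 * r / ρ := fun j => by
    have hj : |v j| ≤ r := Finset.single_le_sum (f := fun j => |v j|)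
      (fun _ _ => abs_nonneg _) (Finset.mem_univ j)
    have h1 : 1 + 2 * (|v j| / (ρ / p)) ≤ p * (1 + 2 * r / ρ) := by
      have : |v j| / (ρ / p) ≤ p * (r / ρ) := by
        rw [div_div_eq_mul_div, mul_comm, mul_div_assoc]
        gcongr
      have e : (p : ℝ) * (1 + 2 * r / ρ) = p + 2 * (p * (r / ρ)) := by ring
      linarith
    refine (Real.log_le_log (by positivity) h1).trans ?_
    rw [Real.log_mul hp'.ne' (by positivity)]
    linarith [Real.log_le_sub_one_of_pos (show 0 < 1 + 2 * r / ρ by positivity)]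
  calc ∑ j, hypDiv (ρ / p) (v j) 0
      ≤ ∑ j, |v j| * (Real.log p + 2 * r / ρ) := Finset.sum_le_sum fun j _ =>
        (hypDiv_zero_le (by positivity) _).trans
          (mul_le_mul_of_nonneg_left (hlog j) (abs_nonneg _))
    _ = r * Real.log p + 2 * r ^ 2 / ρ := by rw [← Finset.sum_mul, ← hr]; ring

/-! ### Mirror maps built from the visited points -/

section Mirror

variable {p m : ℕ} (a b : ℕ → ℝ) (h : Fin m → Fin p → ℝ)

/-- The superposition, with weights `a s`, of hyperbolic entropies at scales `b s` centered at the
points `h s`. -/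
noncomputable def hypMirror (y : Fin p → ℝ) : ℝ :=
  ∑ s : Fin m, a s * ∑ j, hypEntropy (b s) (y j - h s j)

/-- The Bregman divergence of `hypMirror`. -/
noncomputable def hypMirrorDiv (y x : Fin p → ℝ) : ℝ :=
  ∑ s : Fin m, a s * ∑ j, hypDiv (b s) (y j - h s j) (x j - h s j)

variable {a b} (ha : ∀ s, 0 < a s) (hb : ∀ s, 0 < b s)
include hb

theorem hasFDerivAt_hypMirror (y : Fin p → ℝ) :
    HasFDerivAt (hypMirror a b h) (∑ s : Fin m, a s • ∑ j, Real.arsinh ((y j - h s j) / b s) •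
      (ContinuousLinearMap.proj j : (Fin p → ℝ) →L[ℝ] ℝ)) y := by
  refine HasFDerivAt.fun_sum fun s _ => (HasFDerivAt.fun_sum fun j _ => ?_).const_mul _
  exact (hasDerivAt_hypEntropy (hb s) (y j - h s j)).comp_hasFDerivAt y
    ((ContinuousLinearMap.proj j : (Fin p → ℝ) →L[ℝ] ℝ).hasFDerivAt.sub_const (h s j))

theorem fderiv_hypMirror (y v : Fin p → ℝ) : fderiv ℝ (hypMirror a b h) y v =
    ∑ s : Fin m, a s * ∑ j, Real.arsinh ((y j - h s j) / b s) * v j := by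
  rw [(hasFDerivAt_hypMirror h hb y).fderiv]
  simp

theorem bregman_hypMirror (y x : Fin p → ℝ) :
    bregman (hypMirror a b h) y x = hypMirrorDiv a b h y x := by
  rw [bregman, fderiv_hypMirror h hb, hypMirror, hypMirror, hypMirrorDiv,
    ← Finset.sum_add_distrib, ← Finset.sum_sub_distrib]
  refine Finset.sum_congr rfl fun s _ => ?_
  rw [← mul_add, ← mul_sub, ← Finset.sum_add_distrib, ← Finset.sum_sub_distrib]
  congr 1
  refine Finset.sum_congr rfl fun j _ => ?_
  simp only [hypDiv, Pi.sub_apply]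
  ring

include ha

theorem hypMirrorDiv_nonneg (y x : Fin p → ℝ) : 0 ≤ hypMirrorDiv a b h y x :=
  Finset.sum_nonneg fun s _ => mul_nonneg (ha s).le
    (Finset.sum_nonneg fun _ _ => hypDiv_nonneg (hb s) _ _)

theorem hypMirrorDiv_pos (hm : 0 < m) {y x : Fin p → ℝ} (hyx : x ≠ y) :
    0 < hypMirrorDiv a b h y x := by
  obtain ⟨j, hj⟩ := Function.ne_iff.1 hyx
  refine Finset.sum_pos (fun s _ => mul_pos (ha s) ?_) ⟨⟨0, hm⟩, Finset.mem_univ _⟩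
  exact Finset.sum_pos' (fun _ _ => hypDiv_nonneg (hb s) _ _)
    ⟨j, Finset.mem_univ j, hypDiv_pos (hb s) (by simpa using hj)⟩

theorem isMirrorMap_hypMirror (hm : 0 < m) : IsMirrorMap (hypMirror a b h) where
  differentiable y := (hasFDerivAt_hypMirror h hb y).differentiableAt
  strictConvex := by
    refine ⟨convex_univ, fun x _ y _ hxy s t hs ht hst => ?_⟩
    set z := s • x + t • y with hz
    have hxz : z ≠ x := fun e => hxy <| by
      have : t • (y - x) = 0 := by
        have h1 : z = x + t • (y - x) := by
          rw [hz, show s = 1 - t by linarith]; module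
        rw [e] at h1
        simpa using h1.symm
      exact (sub_eq_zero.1 ((smul_eq_zero.1 this).resolve_left ht.ne')).symm
    have hyz : z ≠ y := fun e => hxy <| by
      have : s • (x - y) = 0 := by
        have h1 : z = y + s • (x - y) := by
          rw [hz, show t = 1 - s by linarith]; module
        rw [e] at h1
        simpa using h1.symm
      exact sub_eq_zero.1 ((smul_eq_zero.1 this).resolve_left hs.ne')
    have h1 := hypMirrorDiv_pos h ha hb hm hxz
    have h2 := hypMirrorDiv_pos h ha hb hm hyz
    rw [← bregman_hypMirror h hb, bregman] at h1 h2
    have h0 : s * fderiv ℝ (hypMirror a b h) z (x - z) +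
        t * fderiv ℝ (hypMirror a b h) z (y - z) = 0 := by
      rw [← smul_eq_mul, ← smul_eq_mul, ← map_smul, ← map_smul, ← map_add]
      have : s • (x - z) + t • (y - z) = 0 := by
        have h3 : s • (x - z) + t • (y - z) = z - (s + t) • z := by rw [hz]; module
        rw [h3, hst, one_smul, sub_self]
      rw [this, map_zero]
    simp only [smul_eq_mul]
    have h4 := mul_pos hs h1
    have h5 := mul_pos ht h2
    have h6 : hypMirror a b h z = s * hypMirror a b h z + t * hypMirror a b h z := by
      rw [← add_mul, hst, one_mul]
    linarith
  gradient_surjective L := by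
    -- The gradient acts coordinatewise, by a continuous function of one variable. The term of index
    -- `s` attains its share of the target value at `y s`; at the least (largest) of the `y s` the
    -- whole sum is at most (at least) the target.
    have key : ∀ j : Fin p, ∃ y : ℝ,
        ∑ s : Fin m, a s * Real.arsinh ((y - h s j) / b s) = L (Pi.single j 1) := by
      intro j
      set c := L (Pi.single j 1)
      set A := ∑ s : Fin m, a s with hA
      have hApos : 0 < A := Finset.sum_pos (fun s _ => ha s) ⟨⟨0, hm⟩, Finset.mem_univ _⟩
      have hc : c = ∑ s : Fin m, a s * (c / A) := by
        rw [← Finset.sum_mul, ← hA]; field_simp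
      choose y hy using fun s : Fin m => show ∃ y, Real.arsinh ((y - h s j) / b s) = c / A by
        refine ⟨b s * Real.sinh (c / A) + h s j, ?_⟩
        rw [add_sub_cancel_right, mul_div_cancel_left₀ _ (hb s).ne', Real.arsinh_sinh]
      have hmono : ∀ s : Fin m, ∀ u v : ℝ, u ≤ v →
          Real.arsinh ((u - h s j) / b s) ≤ Real.arsinh ((v - h s j) / b s) := fun s u v huv =>
        Real.arsinh_le_arsinh.2 (div_le_div_of_nonneg_right (by linarith) (hb s).le)
      have hcont : Continuous fun y : ℝ => ∑ s : Fin m, a s * Real.arsinh ((y - h s j) / b s) :=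
        continuous_finsetSum _ fun s _ => continuous_const.mul
          (((continuous_id.sub continuous_const).div_const _).arsinh)
      have hne : (Finset.univ : Finset (Fin m)).Nonempty := ⟨⟨0, hm⟩, Finset.mem_univ _⟩
      refine mem_range_of_exists_le_of_exists_ge hcont
        ⟨Finset.univ.inf' hne y, ?_⟩ ⟨Finset.univ.sup' hne y, ?_⟩
      · rw [hc]
        refine Finset.sum_le_sum fun s _ => mul_le_mul_of_nonneg_left ?_ (ha s).le
        rw [← hy s]
        exact hmono s _ _ (Finset.inf'_le _ (Finset.mem_univ s))
      · rw [hc]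
        refine Finset.sum_le_sum fun s _ => mul_le_mul_of_nonneg_left ?_ (ha s).le
        rw [← hy s]
        exact hmono s _ _ (Finset.le_sup' _ (Finset.mem_univ s))
    choose y hy using key
    refine ⟨y, ?_⟩
    ext v
    have hv : v = ∑ j, v j • (Pi.single j 1 : Fin p → ℝ) := (pi_eq_sum_univ' v)
    conv_rhs => rw [hv, map_sum]
    simp only [fderiv_hypMirror h hb, map_smul, smul_eq_mul, ← hy, Finset.mul_sum]
    rw [Finset.sum_comm]
    refine Finset.sum_congr rfl fun j _ => Finset.sum_congr rfl fun s _ => ?_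
    ring

omit ha hb

/-! ### The mirror descent step -/

/-- On a compact set the minimum that defines the mirror step is attained. -/
theorem isMirrorStep_mirrorStep {X : Set (Fin p → ℝ)} (hX : IsCompact X) (hne : X.Nonempty)
    {Φ : (Fin p → ℝ) → ℝ} (hΦ : Continuous Φ) (η : ℝ) (g x : Fin p → ℝ) :
    IsMirrorStep X Φ η g x (mirrorStep X Φ η g x) := by
  have hc : Continuous fun y => η * (g ⬝ᵥ y) + bregman Φ y x := by
    unfold bregman dotProduct
    fun_prop
  obtain ⟨z, hz, hmin⟩ := hX.exists_isMinOn hne hc.continuousOn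
  have hex : ∃ z, IsMirrorStep X Φ η g x z := ⟨z, hz, fun y hy => hmin hy⟩
  rw [mirrorStep, dif_pos hex]
  exact hex.choose_spec

/-- The three point inequality, from the first order condition at the minimizer `z`. -/
theorem IsMirrorStep.le_bregman {X : Set (Fin p → ℝ)} (hX : Convex ℝ X)
    {Φ : (Fin p → ℝ) → ℝ} (hΦ : Differentiable ℝ Φ) {η : ℝ} {g x z u : Fin p → ℝ}
    (hz : IsMirrorStep X Φ η g x z) (hu : u ∈ X) :
    η * (g ⬝ᵥ (z - u)) ≤ bregman Φ u x - bregman Φ u z - bregman Φ z x := by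
  let G : (Fin p → ℝ) →L[ℝ] ℝ := LinearMap.toContinuousLinearMap (dotProductBilin ℝ ℝ g)
  have hG : ∀ v, G v = g ⬝ᵥ v := fun v => rfl
  have hder : HasFDerivAt (fun y => η * (g ⬝ᵥ y) + bregman Φ y x)
      (η • G + (fderiv ℝ Φ z - fderiv ℝ Φ x)) z := by
    have h1 : HasFDerivAt (fun y => η * (g ⬝ᵥ y)) (η • G) z := G.hasFDerivAt.const_mul η
    have h2 : HasFDerivAt (fun y => fderiv ℝ Φ x (y - x)) (fderiv ℝ Φ x) z :=
      (fderiv ℝ Φ x).hasFDerivAt.comp z ((hasFDerivAt_id z).sub_const x)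
    exact h1.add ((hΦ z).hasFDerivAt.sub (h2.const_add _))
  have hmin : IsMinOn (fun y => η * (g ⬝ᵥ y) + bregman Φ y x) X z := fun y hy => hz.2 y hy
  have h0 := hmin.localize.hasFDerivWithinAt_nonneg hder.hasFDerivWithinAt
    (sub_mem_posTangentConeAt_of_segment_subset (hX.segment_subset hz.1 hu))
  simp only [add_apply, smul_apply, sub_apply, hG,
    smul_eq_mul] at h0
  have e1 : bregman Φ u x - bregman Φ u z - bregman Φ z x =
      fderiv ℝ Φ z (u - z) - fderiv ℝ Φ x (u - z) := by
    have : fderiv ℝ Φ x (u - z) = fderiv ℝ Φ x (u - x) - fderiv ℝ Φ x (z - x) := by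
      rw [← map_sub, sub_sub_sub_cancel_right]
    rw [this]
    simp only [bregman]
    ring
  have e2 : g ⬝ᵥ (z - u) = -(g ⬝ᵥ (u - z)) := by rw [← neg_sub, dotProduct_neg]
  rw [e1, e2]
  linarith

include ha hb

/-- One step of mirror descent with a superposition of hyperbolic entropies. The maximum of an
average is at most the average of the maxima, so that the error splits over the centers. -/
theorem mirrorStep_hypMirror_le {X : Set (Fin p → ℝ)} (hX : IsCompact X) (hXc : Convex ℝ X)
    {u : Fin p → ℝ} (hu : u ∈ X) (η : ℝ) (g x : Fin p → ℝ) :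
    η * (∑ s : Fin m, a s) * (g ⬝ᵥ (x - u)) ≤ hypMirrorDiv a b h u x -
      hypMirrorDiv a b h u (mirrorStep X (hypMirror a b h) (η * ∑ s : Fin m, a s) g x) +
      ∑ s : Fin m, a s * ∑ j, (2 * |x j - h s j| + b s) * (Real.cosh (η * g j) - 1) := by
  have hΦ : Differentiable ℝ (hypMirror a b h) := fun y =>
    (hasFDerivAt_hypMirror h hb y).differentiableAt
  set z := mirrorStep X (hypMirror a b h) (η * ∑ s : Fin m, a s) g x
  have h1 := (isMirrorStep_mirrorStep hX ⟨u, hu⟩ hΦ.continuous (η * ∑ s : Fin m, a s) g x).le_bregman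
    hXc hΦ hu
  simp only [bregman_hypMirror h hb] at h1
  have h2 : η * (∑ s : Fin m, a s) * (g ⬝ᵥ (x - z)) - hypMirrorDiv a b h z x ≤
      ∑ s : Fin m, a s * ∑ j, (2 * |x j - h s j| + b s) * (Real.cosh (η * g j) - 1) := by
    have e : η * (∑ s : Fin m, a s) * (g ⬝ᵥ (x - z)) =
        ∑ s : Fin m, a s * ∑ j, η * g j * (x j - z j) := by
      rw [← Finset.sum_mul, mul_comm η, mul_assoc, dotProduct, Finset.mul_sum]
      congr 1
      exact Finset.sum_congr rfl fun j _ => by simp only [Pi.sub_apply]; ring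
    rw [e, hypMirrorDiv, ← Finset.sum_sub_distrib]
    refine Finset.sum_le_sum fun s _ => ?_
    rw [← mul_sub, ← Finset.sum_sub_distrib]
    refine mul_le_mul_of_nonneg_left (Finset.sum_le_sum fun j _ => ?_) (ha s).le
    have := mul_sub_sub_hypDiv_le (hb s) (η * g j) (x j - h s j) (z j - h s j)
    rwa [sub_sub_sub_cancel_right] at this
  have e3 : g ⬝ᵥ (x - u) = g ⬝ᵥ (x - z) + g ⬝ᵥ (z - u) := by
    rw [← dotProduct_add, sub_add_sub_cancel]
  rw [e3, mul_add]
  linarith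

end Mirror

/-! ### Functions that are strongly convex with respect to the 1-norm -/

theorem fderiv_eq_sum {p : ℕ} (f : (Fin p → ℝ) → ℝ) (x v : Fin p → ℝ) :
    fderiv ℝ f x v = ∑ j, fderiv ℝ f x (Pi.single j 1) * v j := by
  conv_lhs => rw [pi_eq_sum_univ' v, map_sum]
  exact Finset.sum_congr rfl fun j _ => by rw [map_smul, smul_eq_mul, mul_comm]

theorem abs_fderiv_le {p : ℕ} {f : (Fin p → ℝ) → ℝ} {x : Fin p → ℝ} {L : ℝ}
    (h : ∀ j, |fderiv ℝ f x (Pi.single j 1)| ≤ L) (v : Fin p → ℝ) :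
    |fderiv ℝ f x v| ≤ L * ∑ j, |v j| := by
  rw [fderiv_eq_sum, Finset.mul_sum]
  refine (Finset.abs_sum_le_sum_abs _ _).trans (Finset.sum_le_sum fun j _ => ?_)
  rw [abs_mul]
  exact mul_le_mul_of_nonneg_right (h j) (abs_nonneg _)

namespace StronglyConvexOneNorm

variable {p : ℕ} {lam : ℝ} {X : Set (Fin p → ℝ)} {f : (Fin p → ℝ) → ℝ}

theorem le_fderiv (hf : StronglyConvexOneNorm lam X f) {x y : Fin p → ℝ} (hx : x ∈ X)
    (hy : y ∈ X) :
    f x - f y + lam / 2 * (∑ i, |x i - y i|) ^ 2 ≤ fderiv ℝ f x (x - y) := by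
  have := hf x hx y hy
  rw [← neg_sub x y, map_neg] at this
  linarith

/-- A strongly convex function with bounded gradient forces the feasible set to be bounded. -/
theorem isCompact (hf : StronglyConvexOneNorm lam X f) (hlam : 0 < lam) (hX : IsClosed X)
    {L : ℝ} (hL0 : 0 ≤ L)
    (hL : ∀ x ∈ X, ∀ j, |fderiv ℝ f x (Pi.single j 1)| ≤ L) : IsCompact X := by
  refine Metric.isCompact_of_isClosed_isBounded hX (Metric.isBounded_iff.2 ⟨2 * L / lam, ?_⟩)
  intro x hx y hy
  have h1 := hf.le_fderiv hx hy
  have h2 := hf.le_fderiv hy hx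
  have h3 := (le_abs_self _).trans (abs_fderiv_le (hL x hx) (x - y))
  have h4 := (le_abs_self _).trans (abs_fderiv_le (hL y hy) (y - x))
  have e : ∑ j, |(y - x) j| = ∑ j, |x j - y j| :=
    Finset.sum_congr rfl fun j _ => by rw [Pi.sub_apply, abs_sub_comm]
  have e' : ∑ j, |(x - y) j| = ∑ j, |x j - y j| := rfl
  have e'' : ∑ j, |y j - x j| = ∑ j, |x j - y j| := e
  rw [e] at h4
  rw [e'] at h3
  rw [e''] at h2
  set r := ∑ j, |x j - y j| with hr
  have hr0 : 0 ≤ r := Finset.sum_nonneg fun _ _ => abs_nonneg _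
  have hrL : lam * r ^ 2 ≤ 2 * L * r := by linarith
  have hdist : dist x y ≤ r := (dist_pi_le_iff hr0).2 fun j => by
    rw [Real.dist_eq]
    exact Finset.single_le_sum (f := fun j => |x j - y j|) (fun _ _ => abs_nonneg _)
      (Finset.mem_univ j)
  rcases hr0.eq_or_lt with h0 | h0
  · exact hdist.trans (h0 ▸ by positivity)
  · refine hdist.trans ((le_div_iff₀ hlam).2 ?_)
    nlinarith

/-- Jensen's inequality, from the first order condition at the average. -/
theorem map_sum_le (hf : StronglyConvexOneNorm lam X f) (hlam : 0 < lam) (hX : Convex ℝ X)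
    {ι : Type*} [Fintype ι] {w : ι → ℝ} (hw : ∀ i, 0 ≤ w i) (hw1 : ∑ i, w i = 1)
    {x : ι → Fin p → ℝ} (hx : ∀ i, x i ∈ X) : f (∑ i, w i • x i) ≤ ∑ i, w i * f (x i) := by
  set z := ∑ i, w i • x i with hz
  have hzX : z ∈ X := hX.sum_mem (fun i _ => hw i) hw1 fun i _ => hx i
  have h0 : ∑ i, w i * fderiv ℝ f z (x i - z) = 0 := by
    have : ∑ i, w i • (x i - z) = 0 := by
      simp only [smul_sub, Finset.sum_sub_distrib, ← Finset.sum_smul, hw1, one_smul]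
      rw [← hz, sub_self]
    rw [← map_zero (fderiv ℝ f z), ← this, map_sum]
    simp only [map_smul, smul_eq_mul]
  calc f z = ∑ i, w i * (f z + fderiv ℝ f z (x i - z)) := by
        simp only [mul_add, Finset.sum_add_distrib, h0, ← Finset.sum_mul, hw1]
        ring
    _ ≤ ∑ i, w i * f (x i) := Finset.sum_le_sum fun i _ => mul_le_mul_of_nonneg_left (by
        have := hf z hzX (x i) (hx i)
        have h2 : 0 ≤ lam / 2 * (∑ j, |z j - x i j|) ^ 2 := by positivity
        linarith) (hw i)

/-- The linear lower bound with slope `L`, improved by the quadratic term, is minimal at distance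
`L / lam`. -/
theorem sub_le (hf : StronglyConvexOneNorm lam X f) (hlam : 0 < lam) {L : ℝ}
    (hL : ∀ x ∈ X, ∀ j, |fderiv ℝ f x (Pi.single j 1)| ≤ L) {x y : Fin p → ℝ} (hx : x ∈ X)
    (hy : y ∈ X) : f x - f y ≤ L ^ 2 / (2 * lam) := by
  have h1 := hf.le_fderiv hx hy
  have h3 := (le_abs_self _).trans (abs_fderiv_le (hL x hx) (x - y))
  have e' : ∑ j, |(x - y) j| = ∑ j, |x j - y j| := rfl
  rw [e'] at h3
  rw [le_div_iff₀ (by positivity)]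
  nlinarith [sq_nonneg (L - lam * ∑ j, |x j - y j|)]

end StronglyConvexOneNorm

/-! ### Runs of a scheme -/

namespace SMDScheme

variable {p : ℕ} {X : Set (Fin p → ℝ)} (S : SMDScheme p X)

/-- The `t`-th iterate produced from a sequence of gradient estimates. -/
noncomputable def point (g : ℕ → Fin p → ℝ) (t : ℕ) : Fin p → ℝ :=
  S.trajectory g t (Fin.last t)

theorem trajectory_eq (g : ℕ → Fin p → ℝ) (t : ℕ) :
    S.trajectory g t = fun i : Fin (t + 1) => S.point g i := by
  induction t with
  | zero =>
    funext i
    rw [Fin.fin_one_eq_zero i]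
    rfl
  | succ t ih =>
    funext i
    refine Fin.lastCases ?_ (fun i => ?_) i
    · rfl
    · rw [trajectory, Fin.snoc_castSucc, ih]
      rfl

theorem point_succ (g : ℕ → Fin p → ℝ) (t : ℕ) : S.point g (t + 1) =
    mirrorStep X (S.mirror t fun i : Fin (t + 1) => S.point g i) (S.step t) (g t)
      (S.point g t) := by
  conv_lhs => rw [point, trajectory, Fin.snoc_last, trajectory_eq]
  rfl

theorem point_congr {g g' : ℕ → Fin p → ℝ} {t : ℕ} (h : ∀ s < t, g s = g' s) :
    S.point g t = S.point g' t := by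
  have : ∀ t, (∀ s < t, g s = g' s) → S.trajectory g t = S.trajectory g' t := by
    intro t
    induction t with
    | zero => intro _; rfl
    | succ t ih =>
      intro h
      rw [trajectory, trajectory, ih fun s hs => h s (by omega), h t (by omega)]
  rw [point, point, this t h]

theorem point_mem (g : ℕ → Fin p → ℝ) (t : ℕ) : S.point g t ∈ X := by
  induction t with
  | zero => exact S.start_mem
  | succ t ih =>
    rw [point_succ, mirrorStep]
    split_ifs with h
    · exact h.choose_spec.1
    · exact ih

theorem estimates_of_lt (G : Fin p → ℝ) (ω : S.Outcome G) {t : ℕ} (h : t < S.rounds) :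
    S.estimates G ω t = gradEstimate G S.mult (ω ⟨t, h⟩) := by
  rw [estimates, dif_pos h]

theorem point_estimates_congr (G : Fin p → ℝ) {ω ω' : S.Outcome G} {t : ℕ}
    (h : ∀ i : Fin S.rounds, i.val < t → ω i = ω' i) :
    S.point (S.estimates G ω) t = S.point (S.estimates G ω') t := by
  refine S.point_congr fun s hs => ?_
  rw [estimates, estimates]
  split_ifs with hr
  · rw [h ⟨s, hr⟩ hs]
  · rfl

section Run

variable {n : ℕ} (Θ : Parameterization n p) (H : PauliExpansion n)

/-- The conditional law of the answers in round `t`, given the answers of the previous rounds. -/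
noncomputable def roundLaw (t : Fin S.rounds) (ω : S.Outcome (Θ.Gamma H))
    (o : BatchOutcome (Θ.Gamma H) S.mult) : ℝ :=
  batchLaw (Θ.Gamma H) S.mult (Θ.oracleProb H (S.point (S.estimates (Θ.Gamma H) ω) t)) o

theorem runProb_eq (ω : S.Outcome (Θ.Gamma H)) :
    S.runProb Θ H ω = ∏ t, S.roundLaw Θ H t ω (ω t) := by
  simp only [runProb, iterates, trajectory_eq]
  rfl

theorem roundLaw_nonneg (t : Fin S.rounds) (ω : S.Outcome (Θ.Gamma H))
    (o : BatchOutcome (Θ.Gamma H) S.mult) : 0 ≤ S.roundLaw Θ H t ω o := by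
  rw [roundLaw, batchLaw]
  exact Finset.prod_nonneg fun _ _ => Finset.prod_nonneg fun _ _ => Θ.oracleProb_nonneg H _ _ _

theorem runProb_nonneg (ω : S.Outcome (Θ.Gamma H)) : 0 ≤ S.runProb Θ H ω := by
  rw [runProb_eq]
  exact Finset.prod_nonneg fun t _ => S.roundLaw_nonneg Θ H t ω _

theorem sum_roundLaw (t : Fin S.rounds) (ω : S.Outcome (Θ.Gamma H)) :
    ∑ o, S.roundLaw Θ H t ω o = 1 :=
  sum_batchLaw _ _ (Θ.oracleProb_add H _)

/-- A functional of the run that decreases in conditional expectation decreases in expectation. -/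
theorem sum_runProb_mul_le (V : ℕ → S.Outcome (Θ.Gamma H) → ℝ) (v₀ : ℝ) (hV₀ : ∀ ω, V 0 ω ≤ v₀)
    (hV : ∀ (t : Fin S.rounds) (ω : S.Outcome (Θ.Gamma H)),
      ∑ o, S.roundLaw Θ H t ω o * V (t + 1) (Function.update ω t o) ≤ V t ω) :
    ∑ ω, S.runProb Θ H ω * V S.rounds ω ≤ v₀ := by
  simp only [runProb_eq]
  refine sum_prod_mul_le_of_supermartingale (S.roundLaw Θ H) (S.roundLaw_nonneg Θ H)
    (fun t ω ω' h => ?_) V v₀ hV₀ hV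
  funext o
  rw [roundLaw, roundLaw, S.point_estimates_congr _ fun i hi => h i hi]

theorem sum_runProb : ∑ ω, S.runProb Θ H ω = 1 := by
  have h1 := S.sum_runProb_mul_le Θ H (fun _ _ => 1) 1 (fun _ => le_rfl)
    fun t ω => by simp [sum_roundLaw]
  have h2 := S.sum_runProb_mul_le Θ H (fun _ _ => -1) (-1) (fun _ => le_rfl)
    fun t ω => by simp [sum_roundLaw]
  simp only [mul_one, mul_neg, Finset.sum_neg_distrib] at h1 h2
  linarith

/-- Jensen's inequality for the returned parameter. -/
theorem expectedValue_sub_le {lam : ℝ} (hlam : 0 < lam) (hX : Convex ℝ X)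
    (hf : StronglyConvexOneNorm lam X (Θ.objective H)) (c : ℝ) :
    S.expectedValue Θ H - c ≤ ∑ ω, S.runProb Θ H ω * ∑ t : Fin (S.rounds + 1),
      S.weight t * (Θ.objective H (S.point (S.estimates (Θ.Gamma H) ω) t) - c) := by
  have h1 : S.expectedValue Θ H - c =
      ∑ ω, S.runProb Θ H ω * (Θ.objective H (S.output (Θ.Gamma H) ω) - c) := by
    simp only [mul_sub, Finset.sum_sub_distrib, ← Finset.sum_mul, sum_runProb, one_mul]
    rfl
  rw [h1]
  refine Finset.sum_le_sum fun ω _ => mul_le_mul_of_nonneg_left ?_ (S.runProb_nonneg Θ H ω)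
  simp only [mul_sub, Finset.sum_sub_distrib, ← Finset.sum_mul, S.weight_sum, one_mul]
  refine sub_le_sub_right ?_ c
  simp only [output, iterates, trajectory_eq]
  exact hf.map_sum_le hlam hX S.weight_nonneg S.weight_sum fun t => S.point_mem _ _

end Run

end SMDScheme

/-! ### The convergence rate -/

/-- The expectation of one mirror descent step with a superposition of hyperbolic entropies, when the
gradient is replaced by its estimate. -/
theorem sum_batchLaw_mul_hypMirrorDiv_le {p m : ℕ} {a b : ℕ → ℝ} (h : Fin m → Fin p → ℝ)
    (ha : ∀ s, 0 < a s) (hb : ∀ s, 0 < b s) {X : Set (Fin p → ℝ)} (hX : IsCompact X)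
    (hXc : Convex ℝ X) {u : Fin p → ℝ} (hu : u ∈ X) (x : Fin p → ℝ) (G : Fin p → ℝ) (κ : ℝ)
    {π : Fin p → Bool → ℝ} (h0 : ∀ j s, 0 ≤ π j s) (hπ : ∀ j, π j true + π j false = 1)
    (hG : ∀ j, batchSize G κ j = 0 → G j = 0) {η V : ℝ}
    (hN : ∀ j, G j ^ 2 / batchSize G κ j ≤ V)
    (hd : ∀ j, (G j * (π j true - π j false)) ^ 2 ≤ V / 2) (hη : 9 / 4 * (η ^ 2 * V) ≤ 1) :
    ∑ o, batchLaw G κ π o * hypMirrorDiv a b h u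
        (mirrorStep X (hypMirror a b h) (η * ∑ s : Fin m, a s) (gradEstimate G κ o) x) ≤
      hypMirrorDiv a b h u x -
        η * (∑ s : Fin m, a s) * (∑ j, G j * (π j true - π j false) * (x j - u j)) +
      9 / 2 * (η ^ 2 * V) * ∑ s : Fin m, a s * ∑ j, (2 * |x j - h s j| + b s) := by
  have hw : ∀ o, 0 ≤ batchLaw G κ π o := fun o =>
    Finset.prod_nonneg fun j _ => Finset.prod_nonneg fun i _ => h0 _ _
  have hstep : ∀ o, hypMirrorDiv a b h u
        (mirrorStep X (hypMirror a b h) (η * ∑ s : Fin m, a s) (gradEstimate G κ o) x) ≤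
      hypMirrorDiv a b h u x -
        ∑ j, η * (∑ s : Fin m, a s) * (x j - u j) * gradEstimate G κ o j +
      ∑ s : Fin m, a s * ∑ j, (2 * |x j - h s j| + b s) *
        (Real.cosh (η * gradEstimate G κ o j) - 1) := fun o => by
    have := mirrorStep_hypMirror_le h ha hb hX hXc hu η (gradEstimate G κ o) x
    have e : η * (∑ s : Fin m, a s) * (gradEstimate G κ o ⬝ᵥ (x - u)) =
        ∑ j, η * (∑ s : Fin m, a s) * (x j - u j) * gradEstimate G κ o j := by
      rw [dotProduct, Finset.mul_sum]
      exact Finset.sum_congr rfl fun j _ => by rw [Pi.sub_apply]; ring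
    linarith
  refine (Finset.sum_le_sum fun o _ => mul_le_mul_of_nonneg_left (hstep o) (hw o)).trans ?_
  have hswap : ∀ (k : Fin p → ℝ) (F : BatchOutcome G κ → Fin p → ℝ),
      ∑ o, batchLaw G κ π o * ∑ j, k j * F o j = ∑ j, k j * ∑ o, batchLaw G κ π o * F o j := by
    intro k F
    simp only [Finset.mul_sum]
    rw [Finset.sum_comm]
    exact Finset.sum_congr rfl fun j _ => Finset.sum_congr rfl fun o _ => by ring
  have hlin : ∑ o, batchLaw G κ π o *
      ∑ j, η * (∑ s : Fin m, a s) * (x j - u j) * gradEstimate G κ o j =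
      η * (∑ s : Fin m, a s) * (∑ j, G j * (π j true - π j false) * (x j - u j)) := by
    rw [hswap, Finset.mul_sum _ _ (η * ∑ s : Fin m, a s)]
    refine Finset.sum_congr rfl fun j _ => ?_
    rw [sum_batchLaw_mul_gradEstimate G κ hπ j (hG j)]
    ring
  have herr : ∑ o, batchLaw G κ π o * ∑ s : Fin m, a s * ∑ j, (2 * |x j - h s j| + b s) *
        (Real.cosh (η * gradEstimate G κ o j) - 1) ≤
      9 / 2 * (η ^ 2 * V) * ∑ s : Fin m, a s * ∑ j, (2 * |x j - h s j| + b s) := by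
    have e : ∀ o, batchLaw G κ π o * ∑ s : Fin m, a s * ∑ j, (2 * |x j - h s j| + b s) *
        (Real.cosh (η * gradEstimate G κ o j) - 1) = ∑ s : Fin m, a s *
        (batchLaw G κ π o * ∑ j, (2 * |x j - h s j| + b s) *
        (Real.cosh (η * gradEstimate G κ o j) - 1)) := fun o => by
      rw [Finset.mul_sum]
      exact Finset.sum_congr rfl fun s _ => by ring
    simp only [e]
    rw [Finset.sum_comm, Finset.mul_sum]
    refine Finset.sum_le_sum fun s _ => ?_
    rw [← Finset.mul_sum, hswap, mul_left_comm, Finset.mul_sum _ _ (9 / 2 * (η ^ 2 * V))]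
    refine mul_le_mul_of_nonneg_left (Finset.sum_le_sum fun j _ => ?_) (ha s).le
    rw [mul_comm]
    exact mul_le_mul_of_nonneg_right
      (sum_batchLaw_mul_cosh_le G κ h0 hπ j (hG j) (hN j) (hd j) hη)
      (add_nonneg (by positivity) (hb s).le)
  simp only [mul_add, mul_sub, Finset.sum_add_distrib, Finset.sum_sub_distrib, ← Finset.sum_mul,
    sum_batchLaw G κ hπ, one_mul] at hlin herr ⊢
  linarith

/-- The scheme with `T` rounds whose mirror map in round `t` is the superposition of the hyperbolic
entropies centered at all the iterates visited so far. -/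
noncomputable def hypScheme {p : ℕ} {X : Set (Fin p → ℝ)} (T : ℕ) {x₀ : Fin p → ℝ} (hx₀ : x₀ ∈ X)
    {a b : ℕ → ℝ} (ha : ∀ s, 0 < a s) (hb : ∀ s, 0 < b s) {η : ℝ} (hη : 0 < η)
    (w : Fin (T + 1) → ℝ) (hw : ∀ t, 0 ≤ w t) (hw1 : ∑ t, w t = 1) : SMDScheme p X where
  rounds := T
  mult := 1
  start := x₀
  start_mem := hx₀
  mirror _ h := hypMirror a b h
  mirror_isMirrorMap _ h := isMirrorMap_hypMirror h ha hb (Nat.succ_pos _)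
  step t := η * ∑ s : Fin (t + 1), a s
  step_pos _ := mul_pos hη (Finset.sum_pos (fun s _ => ha s) Finset.univ_nonempty)
  weight := w
  weight_nonneg := hw
  weight_sum := hw1

/-- The drift of the potential in one round is at most a constant. Here `t + 1` is the weight of the
new center, `(t + 1) * (t + 2) / 2` the total weight of the centers, `16 / (c * (t + 2))` the scale of
the new entropy, `e` the relative error of a step, and `c` the product of step size and convexity
parameter. With this scale, the quadratic part of the divergence from the new center uses up half of
the gain from strong convexity, and the other half absorbs all terms that are linear in the distance
`r` to the minimizer. -/
theorem drift_le {t T ℓ L c e r : ℝ} (ht : 0 ≤ t) (htT : t + 1 ≤ T) (hℓ : 1 ≤ ℓ) (hL : L ≤ ℓ)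
    (hc : 0 < c) (he : 0 ≤ e) (heT : e * T = 9 / 2 * ℓ) (hr : 0 ≤ r) :
    (t + 1) * (r * L + 2 * r ^ 2 / (16 / (c * (t + 2)))) +
      2 * e * r * ((t + 1) * (t + 2) / 2) +
      e * (T - t) * ((t + 1) * (2 * r + 16 / (c * (t + 2)))) ≤
    c * ((t + 1) * (t + 2) / 2) * (r ^ 2 / 2) + 800 * ℓ ^ 2 / c := by
  have ht1 : 0 < t + 1 := by linarith
  have ht2 : 0 < t + 2 := by linarith
  -- the coefficient of `r`, relative to `t + 1`
  have hlin : L + e * (t + 2) + 2 * (e * (T - t)) ≤ 19 * ℓ := by nlinarith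
  have hlin' : (t + 1) * r * (L + e * (t + 2) + 2 * (e * (T - t))) ≤ (t + 1) * r * (19 * ℓ) :=
    mul_le_mul_of_nonneg_left hlin (by positivity)
  have hconst : e * (T - t) * ((t + 1) * (16 / (c * (t + 2)))) ≤ 72 * ℓ ^ 2 / c := by
    have h1 : (t + 1) * (16 / (c * (t + 2))) ≤ 16 / c := by
      rw [mul_div_assoc', div_le_div_iff₀ (by positivity) hc]
      nlinarith
    have h2 : e * (T - t) ≤ 9 / 2 * ℓ := by nlinarith
    calc e * (T - t) * ((t + 1) * (16 / (c * (t + 2)))) ≤ 9 / 2 * ℓ * (16 / c) :=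
          mul_le_mul h2 h1 (by positivity) (by positivity)
      _ = 72 * ℓ / c := by ring
      _ ≤ 72 * ℓ ^ 2 / c := by
          refine div_le_div_of_nonneg_right ?_ hc.le
          nlinarith
  have hquad : (t + 1) * r * (19 * ℓ) ≤
      c * ((t + 1) * (t + 2) / 2) * (r ^ 2 / 4) + 722 * ℓ ^ 2 / c := by
    -- by completing the square
    have h1 : (t + 1) * r * (19 * ℓ) ≤ c * (t + 1) ^ 2 / 2 * (r ^ 2 / 4) + 722 * ℓ ^ 2 / c := by
      have h2 : c * (t + 1) ^ 2 / 2 * (r ^ 2 / 4) + 722 * ℓ ^ 2 / c - (t + 1) * r * (19 * ℓ) =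
          (c * ((t + 1) * r) - 76 * ℓ) ^ 2 / (8 * c) := by
        field_simp
        ring
      have h3 : 0 ≤ (c * ((t + 1) * r) - 76 * ℓ) ^ 2 / (8 * c) := by positivity
      linarith
    have h4 : c * (t + 1) ^ 2 / 2 * (r ^ 2 / 4) ≤ c * ((t + 1) * (t + 2) / 2) * (r ^ 2 / 4) := by
      refine mul_le_mul_of_nonneg_right ?_ (by positivity)
      nlinarith [mul_pos hc ht1]
    linarith
  have hdiv : (t + 1) * (2 * r ^ 2 / (16 / (c * (t + 2)))) =
      c * ((t + 1) * (t + 2) / 2) * (r ^ 2 / 4) := by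
    field_simp
    ring
  have hsum : 72 * ℓ ^ 2 / c + 722 * ℓ ^ 2 / c ≤ 800 * ℓ ^ 2 / c := by
    rw [← add_div]
    refine div_le_div_of_nonneg_right ?_ hc.le
    nlinarith [sq_nonneg ℓ]
  linarith

theorem sum_fin_succ_eq (t : ℕ) : ∑ s : Fin (t + 1), ((s : ℕ) + 1 : ℝ) = (t + 1) * (t + 2) / 2 := by
  induction t with
  | zero => simp
  | succ t ih =>
    rw [Fin.sum_univ_castSucc]
    simp only [Fin.val_castSucc, Fin.val_last]
    rw [ih]
    push_cast
    ring

theorem sum_fin_mul_eq (T : ℕ) :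
    ∑ s : Fin T, (((s : ℕ) + 1) * ((s : ℕ) + 2) / 2 : ℝ) = T * (T + 1) * (T + 2) / 6 := by
  induction T with
  | zero => simp
  | succ T ih =>
    rw [Fin.sum_univ_castSucc]
    simp only [Fin.val_castSucc, Fin.val_last]
    rw [ih]
    push_cast
    ring

namespace SMDScheme

variable {n p : ℕ} {X : Set (Fin p → ℝ)} (S : SMDScheme p X) (Θ : Parameterization n p)
  (H : PauliExpansion n)

/-- The weighted sum of the expected optimality gaps along a run. The potential consists of the
divergence of the minimizer from the current iterate, with respect to the centers used so far, and of
a reserve that pays for the errors which these centers cause in the future rounds. -/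
theorem sum_runProb_mul_gap_le (hp : 0 < p) (hX : IsCompact X) (hXc : Convex ℝ X) {lam : ℝ}
    (hlam : 0 < lam) (hf : StronglyConvexOneNorm lam X (Θ.objective H)) {u : Fin p → ℝ}
    (hu : u ∈ X) {η V ℓ : ℝ} (hη : 0 < η) (hV : 0 ≤ V) (hℓ : 1 + Real.log p ≤ ℓ)
    (hηV : η ^ 2 * V * S.rounds = ℓ) (hℓT : 9 / 4 * ℓ ≤ S.rounds)
    (hmir : ∀ t h, S.mirror t h =
      hypMirror (fun s => (s : ℝ) + 1) (fun s => 16 / (η * lam * (s + 2)) / p) h)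
    (hstep : ∀ t : ℕ, S.step t = η * ∑ s : Fin (t + 1), ((s : ℕ) + 1 : ℝ))
    (hG : ∀ j, batchSize (Θ.Gamma H) S.mult j = 0 → Θ.Gamma H j = 0)
    (hN : ∀ j, Θ.Gamma H j ^ 2 / batchSize (Θ.Gamma H) S.mult j ≤ V)
    (hd : ∀ x ∈ X, ∀ j, fderiv ℝ (Θ.objective H) x (Pi.single j 1) ^ 2 ≤ V / 2) :
    ∑ ω, S.runProb Θ H ω * ∑ t : Fin S.rounds, η * (((t : ℕ) + 1) * ((t : ℕ) + 2) / 2) *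
        (Θ.objective H (S.point (S.estimates (Θ.Gamma H) ω) t) - Θ.objective H u) ≤
      S.rounds * (800 * ℓ ^ 2 / (η * lam)) := by
  set f := Θ.objective H with hfdef
  set T := S.rounds with hT
  have hp' : (0 : ℝ) < p := by exact_mod_cast hp
  have hlogp : 0 ≤ Real.log p := Real.log_natCast_nonneg p
  have hℓ1 : 1 ≤ ℓ := by linarith
  have hTpos : (0 : ℝ) < T := by linarith
  have hc : 0 < η * lam := mul_pos hη hlam
  let a : ℕ → ℝ := fun s => (s : ℝ) + 1
  let ρ : ℕ → ℝ := fun s => 16 / (η * lam * (s + 2))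
  let b : ℕ → ℝ := fun s => ρ s / p
  have ha : ∀ s, 0 < a s := fun s => by positivity
  have hρ : ∀ s, 0 < ρ s := fun s => by positivity
  have hb : ∀ s, 0 < b s := fun s => div_pos (hρ s) hp'
  let e : ℝ := 9 / 2 * (η ^ 2 * V)
  have he : 0 ≤ e := by positivity
  have heT : e * T = 9 / 2 * ℓ := by rw [← hηV]; ring
  have hη1 : 9 / 4 * (η ^ 2 * V) ≤ 1 := by
    have : 9 / 4 * (η ^ 2 * V) * T ≤ 1 * T := by linarith
    exact le_of_mul_le_mul_right this hTpos
  let pt : S.Outcome (Θ.Gamma H) → ℕ → Fin p → ℝ := fun ω => S.point (S.estimates (Θ.Gamma H) ω)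
  have hpt : ∀ ω t, pt ω t ∈ X := fun ω t => S.point_mem _ _
  let r : S.Outcome (Θ.Gamma H) → ℕ → ℝ := fun ω t => ∑ j, |pt ω t j - u j|
  have hr : ∀ ω t, 0 ≤ r ω t := fun ω t => Finset.sum_nonneg fun _ _ => abs_nonneg _
  let κ : ℝ := 800 * ℓ ^ 2 / (η * lam)
  let gap : S.Outcome (Θ.Gamma H) → ℕ → ℝ := fun ω t =>
    η * (((t : ℕ) + 1) * ((t : ℕ) + 2) / 2) * (f (pt ω t) - f u)
  -- the potential plus the accumulated gaps, minus the allowed drift `κ` per round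
  let W : ℕ → S.Outcome (Θ.Gamma H) → ℝ := fun t ω =>
    hypMirrorDiv a b (fun s : Fin t => pt ω s) u (pt ω t) +
      e * (T - t) * ∑ s : Fin t, a s * (2 * r ω s + ρ s) + ∑ s : Fin t, (gap ω s - κ)
  have key := S.sum_runProb_mul_le Θ H W 0 (fun ω => by simp [W, hypMirrorDiv]) ?_
  · have hfin : ∀ ω, ∑ t : Fin T, gap ω t - T * κ ≤ W T ω := fun ω => by
      have h1 := hypMirrorDiv_nonneg (fun s : Fin T => pt ω s) ha hb u (pt ω T)
      simp only [W, sub_self, mul_zero, zero_mul, Finset.sum_sub_distrib, Finset.sum_const,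
        Finset.card_univ, Fintype.card_fin, nsmul_eq_mul]
      linarith
    have h2 := (Finset.sum_le_sum fun ω _ =>
      mul_le_mul_of_nonneg_left (hfin ω) (S.runProb_nonneg Θ H ω)).trans key
    simp only [mul_sub, Finset.sum_sub_distrib, ← Finset.sum_mul, S.sum_runProb Θ H, one_mul] at h2
    exact sub_nonpos.1 h2
  · intro t ω
    have htT : (t : ℝ) + 1 ≤ T := by exact_mod_cast t.isLt
    set x := pt ω t with hx
    let h : Fin (t + 1) → Fin p → ℝ := fun s => pt ω s
    have hpast : ∀ o (s : ℕ), s ≤ t → pt (Function.update ω t o) s = pt ω s := fun o s hs =>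
      S.point_estimates_congr _ fun i hi => Function.update_of_ne (by
        rintro rfl; omega) _ _
    have hnext : ∀ o, pt (Function.update ω t o) (t + 1) =
        mirrorStep X (hypMirror a b h) (η * ∑ s : Fin (t + 1), a s)
          (gradEstimate (Θ.Gamma H) S.mult o) x := fun o => by
      have h1 := S.point_succ (S.estimates (Θ.Gamma H) (Function.update ω t o)) t
      rw [S.estimates_of_lt _ _ t.isLt, hstep, hmir] at h1
      have h2 : (fun i : Fin (t + 1) =>
          S.point (S.estimates (Θ.Gamma H) (Function.update ω t o)) i) = h := by
        funext i
        exact hpast o i (by omega)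
      rw [h2] at h1
      have h3 : S.point (S.estimates (Θ.Gamma H) (Function.update ω t o)) t = x :=
        hpast o t le_rfl
      rw [h3, Fin.eta, Function.update_self] at h1
      exact h1
    let K : ℝ := e * (T - (t + 1)) * ∑ s : Fin (t + 1), a s * (2 * r ω s + ρ s) +
      ∑ s : Fin (t + 1), (gap ω s - κ)
    have hW : ∀ o, W (t + 1) (Function.update ω t o) =
        hypMirrorDiv a b h u (mirrorStep X (hypMirror a b h) (η * ∑ s : Fin (t + 1), a s)
          (gradEstimate (Θ.Gamma H) S.mult o) x) + K := fun o => by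
      have h1 : (fun s : Fin (t + 1) => pt (Function.update ω t o) s) = h := by
        funext s
        exact hpast o s (by omega)
      have h2 : ∀ s : Fin (t + 1), r (Function.update ω t o) s = r ω s := fun s => by
        simp only [r, hpast o s (by omega)]
      have h3 : ∀ s : Fin (t + 1), gap (Function.update ω t o) s = gap ω s := fun s => by
        simp only [gap, hpast o s (by omega)]
      simp only [W, K, h1, h2, h3, hnext]
      push_cast
      ring
    have hmean : ∀ j, Θ.Gamma H j * (Θ.oracleProb H x j true - Θ.oracleProb H x j false) =
        fderiv ℝ f x (Pi.single j 1) := Θ.oracleProb_sub H x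
    have hexp := sum_batchLaw_mul_hypMirrorDiv_le h ha hb hX hXc hu x (Θ.Gamma H) S.mult
      (Θ.oracleProb_nonneg H x) (Θ.oracleProb_add H x) hG hN
      (fun j => by rw [hmean]; exact hd x (hpt ω t) j) hη1
    have hA : ∑ s : Fin (t + 1), a s = ((t : ℕ) + 1) * ((t : ℕ) + 2) / 2 := sum_fin_succ_eq t
    have hgrad : f x - f u + lam / 2 * r ω t ^ 2 ≤
        ∑ j, Θ.Gamma H j * (Θ.oracleProb H x j true - Θ.oracleProb H x j false) *
          (x j - u j) := by
      have h1 := hf.le_fderiv (hpt ω t) hu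
      rw [fderiv_eq_sum] at h1
      simp only [hmean]
      exact h1
    have hdist : ∑ s : Fin (t + 1), a s * ∑ j, (2 * |x j - h s j| + b s) ≤
        2 * r ω t * (((t : ℕ) + 1) * ((t : ℕ) + 2) / 2) +
          ∑ s : Fin (t + 1), a s * (2 * r ω s + ρ s) := by
      rw [← hA, Finset.mul_sum, ← Finset.sum_add_distrib]
      refine Finset.sum_le_sum fun s _ => ?_
      have h1 : ∑ j, (2 * |x j - h s j| + b s) ≤ 2 * r ω t + (2 * r ω s + ρ s) := by
        rw [Finset.sum_add_distrib, ← Finset.mul_sum, Finset.sum_const, Finset.card_univ,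
          Fintype.card_fin, nsmul_eq_mul, show (p : ℝ) * b s = ρ s from mul_div_cancel₀ _ hp'.ne']
        have h2 : ∑ j, |x j - h s j| ≤ r ω t + r ω s := by
          simp only [r, ← Finset.sum_add_distrib]
          refine Finset.sum_le_sum fun j _ => ?_
          rw [abs_sub_comm (pt ω s j)]
          exact abs_sub_le _ _ _
        linarith
      nlinarith [mul_le_mul_of_nonneg_left h1 (ha s).le]
    have hcenter : hypMirrorDiv a b h u x ≤
        hypMirrorDiv a b (fun s : Fin t => pt ω s) u x +
          (t + 1) * (r ω t * Real.log p + 2 * r ω t ^ 2 / ρ t) := by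
      rw [hypMirrorDiv, Fin.sum_univ_castSucc]
      refine add_le_add le_rfl (mul_le_mul_of_nonneg_left ?_ (ha _).le)
      have h1 := sum_hypDiv_zero_le hp (hρ t) fun j => u j - x j
      have h2 : ∑ j, |u j - x j| = r ω t := Finset.sum_congr rfl fun j _ => abs_sub_comm _ _
      rw [h2] at h1
      have h3 : ∀ j, x j - h (Fin.last t) j = 0 := fun j => sub_self _
      simp only [h3]
      exact h1
    have hdrift := drift_le (t := (t : ℕ)) (Nat.cast_nonneg _) htT hℓ1
      (show Real.log p ≤ ℓ by linarith) hc he heT (hr ω t)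
    have hsum1 : ∑ s : Fin (t + 1), a s * (2 * r ω s + ρ s) =
        ∑ s : Fin t, a s * (2 * r ω s + ρ s) + (t + 1) * (2 * r ω t + ρ t) := by
      rw [Fin.sum_univ_castSucc]
      rfl
    have hsum2 : ∑ s : Fin (t + 1), (gap ω s - κ) = ∑ s : Fin t, (gap ω s - κ) +
        (gap ω t - κ) := by
      rw [Fin.sum_univ_castSucc]
      rfl
    have hlhs : ∑ o, S.roundLaw Θ H t ω o * W (t + 1) (Function.update ω t o) =
        ∑ o, batchLaw (Θ.Gamma H) S.mult (Θ.oracleProb H x) o *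
          hypMirrorDiv a b h u (mirrorStep X (hypMirror a b h) (η * ∑ s : Fin (t + 1), a s)
          (gradEstimate (Θ.Gamma H) S.mult o) x) + K := by
      simp only [hW, mul_add, Finset.sum_add_distrib, ← Finset.sum_mul, S.sum_roundLaw Θ H, one_mul]
      rfl
    rw [hlhs, hA]
    have hS : (0 : ℝ) ≤ η * (((t : ℕ) + 1) * ((t : ℕ) + 2) / 2) := by positivity
    rw [hA] at hexp
    have hgrad' := mul_le_mul_of_nonneg_left hgrad hS
    have hdist' := mul_le_mul_of_nonneg_left hdist he
    simp only [W, K, hsum1, hsum2] at hdist' ⊢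
    have hgap : gap ω t = η * (((t : ℕ) + 1) * ((t : ℕ) + 2) / 2) * (f x - f u) := rfl
    have hρt : 16 / (η * lam * ((t : ℕ) + 2)) = ρ t := rfl
    have hκ : 800 * ℓ ^ 2 / (η * lam) = κ := rfl
    have hee : 9 / 2 * (η ^ 2 * V) = e := rfl
    rw [hρt, hκ] at hdrift
    rw [hee] at hexp
    rw [hgap, ← hx]
    linarith

end SMDScheme

/-! ### The choice of the parameters and the number of queries -/

/-- `ℓ₂`-sampling equalizes the variances of the coordinates of the gradient estimate. -/
theorem sq_div_batchSize_le {p : ℕ} (hp : 0 < p) (G : Fin p → ℝ) (hG : 0 < ∑ i, G i ^ 2)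
    (j : Fin p) : G j ^ 2 / batchSize G 1 j ≤ (∑ i, G i ^ 2) / p := by
  have hp' : (0 : ℝ) < p := by exact_mod_cast hp
  refine div_le_of_le_mul₀ (Nat.cast_nonneg _) (by positivity) ?_
  have h := Nat.le_ceil ((p : ℝ) * (G j ^ 2 / ∑ i, G i ^ 2) * 1)
  calc G j ^ 2 = (∑ i, G i ^ 2) / p * ((p : ℝ) * (G j ^ 2 / ∑ i, G i ^ 2) * 1) := by
        field_simp
    _ ≤ _ := mul_le_mul_of_nonneg_left h (by positivity)

theorem eq_zero_of_batchSize_eq_zero {p : ℕ} (hp : 0 < p) (G : Fin p → ℝ)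
    (hG : 0 < ∑ i, G i ^ 2) (j : Fin p) (h : batchSize G 1 j = 0) : G j = 0 := by
  have hp' : (0 : ℝ) < p := by exact_mod_cast hp
  have h1 := Nat.ceil_eq_zero.1 h
  by_contra hj
  have : 0 < (p : ℝ) * (G j ^ 2 / ∑ i, G i ^ 2) * 1 := by positivity
  linarith

theorem sum_batchSize_le {p : ℕ} (G : Fin p → ℝ) :
    ((∑ j, batchSize G 1 j : ℕ) : ℝ) ≤ 2 * p := by
  have h0 : 0 ≤ ∑ i, G i ^ 2 := Finset.sum_nonneg fun _ _ => sq_nonneg _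
  push_cast
  calc ∑ j, (batchSize G 1 j : ℝ) ≤ ∑ j, ((p : ℝ) * (G j ^ 2 / ∑ i, G i ^ 2) * 1 + 1) :=
        Finset.sum_le_sum fun j _ => (Nat.ceil_lt_add_one (by positivity)).le
    _ = p * ((∑ j, G j ^ 2) / ∑ i, G i ^ 2) + p := by
        rw [Finset.sum_add_distrib, ← Finset.sum_mul, ← Finset.mul_sum, ← Finset.sum_div]
        simp
    _ ≤ p * 1 + p := by
        gcongr
        exact div_self_le_one _
    _ = 2 * p := by ring

section Schemes

variable {p : ℕ} (hp : 0 < p) {X : Set (Fin p → ℝ)} (hX : IsClosed X) (hXc : Convex ℝ X)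
  (hne : X.Nonempty) (G : Fin p → ℝ) {lam ε : ℝ} (hlam : 0 < lam) (hε : 0 < ε)

/-- For every objective with normalization factors `G` that is strongly convex and has bounded
gradient on `X`, the expected value of the output exceeds the minimum by at most `ε`. -/
def SMDScheme.IsAccurate (S : SMDScheme p X) (G : Fin p → ℝ) (lam ε : ℝ) : Prop :=
  ∀ (n : ℕ) (Θ : Parameterization n p) (H : PauliExpansion n), Θ.Gamma H = G →
    StronglyConvexOneNorm lam X (Θ.objective H) →
    (∀ θ ∈ X, ∀ j, |fderiv ℝ (Θ.objective H) θ (Pi.single j 1)| ≤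
      Real.sqrt (∑ i, G i ^ 2) / Real.sqrt (2 * p)) →
    ∃ θmin ∈ X, IsMinOn (Θ.objective H) X θmin ∧
      S.expectedValue Θ H - Θ.objective H θmin ≤ ε

include hp hX hXc hne hlam in
/-- If the accuracy is coarse, strong convexity and the gradient bound make every starting point
accurate enough. -/
theorem exists_isAccurate_of_le (h : (∑ i, G i ^ 2) / p ≤ 4 * (lam * ε)) :
    ∃ S : SMDScheme p X, S.mult = 1 ∧ S.rounds = 0 ∧ S.IsAccurate G lam ε := by
  obtain ⟨x₀, hx₀⟩ := hne
  let S : SMDScheme p X := hypScheme 0 hx₀ (a := fun _ => 1) (b := fun _ => 1)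
    (fun _ => one_pos) (fun _ => one_pos) (η := 1) one_pos (fun _ => 1)
    (fun _ => zero_le_one) (by simp)
  refine ⟨S, rfl, rfl, fun n Θ H hG hf hgrad => ?_⟩
  subst hG
  have hp' : (0 : ℝ) < p := by exact_mod_cast hp
  have hcomp := hf.isCompact hlam hX (by positivity) hgrad
  obtain ⟨u, hu, hmin⟩ := hcomp.exists_isMinOn ⟨x₀, hx₀⟩
    (Θ.differentiable_objective H).continuous.continuousOn
  refine ⟨u, hu, hmin, ?_⟩
  have h1 := S.expectedValue_sub_le Θ H hlam hXc hf (Θ.objective H u)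
  have h2 : ∀ ω, ∑ t : Fin (S.rounds + 1), S.weight t *
      (Θ.objective H (S.point (S.estimates (Θ.Gamma H) ω) t) - Θ.objective H u) =
      Θ.objective H x₀ - Θ.objective H u := fun ω => by
    change ∑ t : Fin (0 + 1), (1 : ℝ) * _ = _
    rw [Fin.sum_univ_castSucc]
    simp only [Finset.univ_eq_empty, Finset.sum_empty, zero_add, one_mul]
    rfl
  simp only [h2, ← Finset.sum_mul, S.sum_runProb Θ H, one_mul] at h1
  have h3 := hf.sub_le hlam hgrad hx₀ hu
  have h4 : (√(∑ i, Θ.Gamma H i ^ 2) / √(2 * p)) ^ 2 / (2 * lam) ≤ ε := by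
    rw [div_pow, Real.sq_sqrt (Finset.sum_nonneg fun _ _ => sq_nonneg _),
      Real.sq_sqrt (by positivity), div_le_iff₀ (by positivity)]
    have : (∑ i, Θ.Gamma H i ^ 2) / (2 * p) = (∑ i, Θ.Gamma H i ^ 2) / p / 2 := by
      field_simp
    rw [this]
    linarith
  linarith

include hp hX hXc hne hlam hε in
/-- With step size of order `√(log p / T) / ‖Γ‖₂ · √p` and output weights proportional to the total
weight of the centers, the gap after `T` rounds is of order `‖Γ‖₂² log p / (p λ T)`. -/
theorem exists_isAccurate_of_lt (h : 4 * (lam * ε) < (∑ i, G i ^ 2) / p) (T : ℕ)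
    (hT : 4800 * (1 + Real.log p) * ((∑ i, G i ^ 2) / p) / (lam * ε) ≤ T) :
    ∃ S : SMDScheme p X, S.mult = 1 ∧ S.rounds = T ∧ S.IsAccurate G lam ε := by
  obtain ⟨x₀, hx₀⟩ := hne
  have hp' : (0 : ℝ) < p := by exact_mod_cast hp
  have hlogp : 0 ≤ Real.log p := Real.log_natCast_nonneg p
  have hle : 0 < lam * ε := mul_pos hlam hε
  obtain ⟨V, hV⟩ : ∃ V, V = (∑ i, G i ^ 2) / p := ⟨_, rfl⟩
  obtain ⟨ℓ, hℓ⟩ : ∃ ℓ, ℓ = 1 + Real.log p := ⟨_, rfl⟩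
  rw [← hV] at h hT
  rw [← hℓ] at hT
  have hVpos : 0 < V := by linarith
  have hℓ1 : 1 ≤ ℓ := by linarith
  have hGpos : 0 < ∑ i, G i ^ 2 := by
    rw [hV] at hVpos
    exact (div_pos_iff_of_pos_right hp').1 hVpos
  have hT1 : 4800 * ℓ * 4 ≤ (T : ℝ) := by
    refine le_trans ?_ hT
    rw [mul_div_assoc]
    exact mul_le_mul_of_nonneg_left ((le_div_iff₀ hle).2 h.le) (by positivity)
  have hTpos : (0 : ℝ) < T := by linarith
  let η : ℝ := √(ℓ / (T * V))
  have hη : 0 < η := Real.sqrt_pos.2 (by positivity)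
  have hη2 : η ^ 2 * V * T = ℓ := by
    rw [Real.sq_sqrt (by positivity)]
    field_simp
  let Z : ℝ := T * (T + 1) * (T + 2) / 6
  have hZ : 0 < Z := by positivity
  let w : Fin (T + 1) → ℝ := fun t =>
    if t.val < T then ((t : ℕ) + 1) * ((t : ℕ) + 2) / 2 / Z else 0
  have hwc : ∀ t : Fin T, w t.castSucc = ((t : ℕ) + 1) * ((t : ℕ) + 2) / 2 / Z := fun t => by
    simp [w]
  have hwl : w (Fin.last T) = 0 := by simp [w]
  have hw : ∀ t, 0 ≤ w t := fun t => by
    simp only [w]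
    split_ifs <;> positivity
  have hw1 : ∑ t, w t = 1 := by
    rw [Fin.sum_univ_castSucc, hwl, add_zero]
    simp only [hwc]
    rw [← Finset.sum_div, sum_fin_mul_eq]
    exact div_self hZ.ne'
  let S : SMDScheme p X := hypScheme T hx₀ (a := fun s => (s : ℝ) + 1)
    (b := fun s => 16 / (η * lam * (s + 2)) / p) (fun s => by positivity) (fun s => by positivity)
    hη w hw hw1
  refine ⟨S, rfl, rfl, fun n Θ H hG hf hgrad => ?_⟩
  subst hG
  have hcomp := hf.isCompact hlam hX (by positivity) hgrad
  obtain ⟨u, hu, hmin⟩ := hcomp.exists_isMinOn ⟨x₀, hx₀⟩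
    (Θ.differentiable_objective H).continuous.continuousOn
  refine ⟨u, hu, hmin, ?_⟩
  have hd : ∀ x ∈ X, ∀ j, fderiv ℝ (Θ.objective H) x (Pi.single j 1) ^ 2 ≤ V / 2 := by
    intro x hx j
    rw [← sq_abs]
    refine (pow_le_pow_left₀ (abs_nonneg _) (hgrad x hx j) 2).trans (le_of_eq ?_)
    rw [div_pow, Real.sq_sqrt hGpos.le, Real.sq_sqrt (by positivity), hV]
    field_simp
  have hgap := S.sum_runProb_mul_gap_le Θ H hp hcomp hXc hlam hf hu hη hVpos.le hℓ.ge hη2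
    (show 9 / 4 * ℓ ≤ (T : ℝ) by linarith) (fun _ _ => rfl) (fun _ => rfl)
    (eq_zero_of_batchSize_eq_zero hp _ hGpos)
    (fun j => (sq_div_batchSize_le hp _ hGpos j).trans hV.ge) hd
  have h1 := S.expectedValue_sub_le Θ H hlam hXc hf (Θ.objective H u)
  have h2 : ∀ ω, ∑ t : Fin (S.rounds + 1), S.weight t *
      (Θ.objective H (S.point (S.estimates (Θ.Gamma H) ω) t) - Θ.objective H u) =
      (η * Z)⁻¹ * ∑ t : Fin S.rounds, η * (((t : ℕ) + 1) * ((t : ℕ) + 2) / 2) *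
        (Θ.objective H (S.point (S.estimates (Θ.Gamma H) ω) t) - Θ.objective H u) := fun ω => by
    rw [Fin.sum_univ_castSucc, show S.weight (Fin.last S.rounds) = 0 from hwl, zero_mul, add_zero,
      Finset.mul_sum]
    refine Finset.sum_congr rfl fun t _ => ?_
    rw [show S.weight t.castSucc = _ from hwc t]
    have hη' := hη.ne'
    have hZ' := hZ.ne'
    rw [Fin.val_castSucc]
    field_simp
  have h3 : S.expectedValue Θ H - Θ.objective H u ≤
      (η * Z)⁻¹ * (T * (800 * ℓ ^ 2 / (η * lam))) := by
    refine h1.trans ?_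
    simp only [h2, mul_left_comm _ (η * Z)⁻¹]
    rw [← Finset.mul_sum]
    exact mul_le_mul_of_nonneg_left hgap (by positivity)
  refine h3.trans ?_
  have hZT : (T : ℝ) ^ 3 / 6 ≤ Z := by
    simp only [Z]
    nlinarith [sq_nonneg (T : ℝ)]
  calc (η * Z)⁻¹ * (T * (800 * ℓ ^ 2 / (η * lam)))
      = T * (800 * ℓ ^ 2) / (η ^ 2 * lam) / Z := by field_simp
    _ ≤ T * (800 * ℓ ^ 2) / (η ^ 2 * lam) / (T ^ 3 / 6) :=
        div_le_div_of_nonneg_left (by positivity) (by positivity) hZT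
    _ = 4800 * ℓ * V / lam / T := by
        have h4 : η ^ 2 = ℓ / (T * V) := Real.sq_sqrt (by positivity)
        rw [h4]
        field_simp
        norm_num
    _ ≤ ε := by
        rw [div_le_iff₀ hle] at hT
        rw [div_le_iff₀ hTpos, div_le_iff₀ hlam]
        linarith

end Schemes

theorem mainTheorem7 :
    ∃ C : ℝ, ∀ (p : ℕ) (_ : 0 < p) (X : Set (Fin p → ℝ)) (_ : X.Nonempty) (_ : IsClosed X)
      (_ : Convex ℝ X) (G : Fin p → ℝ) (lam ε : ℝ) (_ : 0 < lam) (_ : 0 < ε),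
      ∃ S : SMDScheme p X,
        0 < S.mult ∧
        (S.queries G : ℝ) ≤ C * ((∑ j, G j ^ 2) / (ε * lam)) *
          (1 + Real.log (4 * (p : ℝ) ^ 2 * (‖G‖ ^ 2 / ∑ j, G j ^ 2))) ∧
        (2 ≤ p → (S.queries G : ℝ) ≤ C * ((∑ j, G j ^ 2) * Real.log p / (ε * lam))) ∧
        ∀ (n : ℕ) (Θ : Parameterization n p) (H : PauliExpansion n), Θ.Gamma H = G →
          StronglyConvexOneNorm lam X (Θ.objective H) →
          (∀ θ ∈ X, ∀ j, |fderiv ℝ (Θ.objective H) θ (Pi.single j 1)| ≤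
            Real.sqrt (∑ i, G i ^ 2) / Real.sqrt (2 * p)) →
          ∃ θmin ∈ X, IsMinOn (Θ.objective H) X θmin ∧
            S.expectedValue Θ H - Θ.objective H θmin ≤ ε := by
  refine ⟨30000, fun p hp X hne hX hXc G lam ε hlam hε => ?_⟩
  have hp' : (0 : ℝ) < p := by exact_mod_cast hp
  have hlogp : 0 ≤ Real.log p := Real.log_natCast_nonneg p
  have hle : 0 < lam * ε := mul_pos hlam hε
  set Q := ∑ j, G j ^ 2 with hQ
  have hQ0 : 0 ≤ Q := Finset.sum_nonneg fun _ _ => sq_nonneg _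
  -- Both claimed bounds dominate the bound with the factor `1 + log p`, since `‖Γ‖₂² ≤ p ‖Γ‖_∞²`.
  have hlog : 0 < Q → 1 + Real.log p ≤ 1 + Real.log (4 * (p : ℝ) ^ 2 * (‖G‖ ^ 2 / Q)) := by
    intro hQpos
    have h1 : Q ≤ p * ‖G‖ ^ 2 := by
      calc Q ≤ ∑ _j : Fin p, ‖G‖ ^ 2 := Finset.sum_le_sum fun j _ => by
            rw [← sq_abs (G j), ← Real.norm_eq_abs]
            exact pow_le_pow_left₀ (norm_nonneg _) (norm_le_pi_norm G j) 2
        _ = p * ‖G‖ ^ 2 := by simp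
    have h2 : (p : ℝ) ≤ 4 * (p : ℝ) ^ 2 * (‖G‖ ^ 2 / Q) := by
      rw [mul_div_assoc', le_div_iff₀ hQpos]
      nlinarith [mul_le_mul_of_nonneg_left h1 hp'.le, mul_pos hp' hQpos]
    linarith [Real.log_le_log hp' h2]
  have hlog2 : 2 ≤ p → 1 + Real.log p ≤ 3 * Real.log p := by
    intro h2
    have h3 : Real.log 2 ≤ Real.log p := Real.log_le_log two_pos (by exact_mod_cast h2)
    linarith [Real.log_two_gt_d9]
  have bounds : ∀ N : ℝ, N ≤ 9602 * (Q / (ε * lam)) * (1 + Real.log p) →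
      N ≤ 30000 * (Q / (ε * lam)) * (1 + Real.log (4 * (p : ℝ) ^ 2 * (‖G‖ ^ 2 / Q))) ∧
      (2 ≤ p → N ≤ 30000 * (Q * Real.log p / (ε * lam))) := by
    intro N hN
    have hq : 0 ≤ Q / (ε * lam) := by positivity
    refine ⟨?_, fun h2 => ?_⟩
    · rcases hQ0.eq_or_lt with h0 | h0
      · rw [← h0] at hN ⊢
        simpa using hN
      · have h1 := mul_le_mul_of_nonneg_left (hlog h0) hq
        have h3 : 0 ≤ Q / (ε * lam) * (1 + Real.log p) := by positivity
        linarith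
    · have h1 := mul_le_mul_of_nonneg_left (hlog2 h2) hq
      have h3 : 0 ≤ Q / (ε * lam) * Real.log p := by positivity
      have h4 : Q * Real.log p / (ε * lam) = Q / (ε * lam) * Real.log p := by ring
      rw [h4]
      linarith
  rcases le_or_gt (Q / p) (4 * (lam * ε)) with h | h
  · obtain ⟨S, hm, hr, hS⟩ := exists_isAccurate_of_le hp hX hXc hne G hlam h
    have hN : (S.queries G : ℝ) = 0 := by rw [SMDScheme.queries, hr]; simp
    obtain ⟨h1, h2⟩ := bounds (S.queries G) (by rw [hN]; positivity)
    exact ⟨S, by rw [hm]; exact one_pos, h1, h2, hS⟩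
  · obtain ⟨S, hm, hr, hS⟩ := exists_isAccurate_of_lt hp hX hXc hne G hlam hε h
      ⌈4800 * (1 + Real.log p) * (Q / p) / (lam * ε)⌉₊ (Nat.le_ceil _)
    have hN : (S.queries G : ℝ) ≤ 9602 * (Q / (ε * lam)) * (1 + Real.log p) := by
      rw [SMDScheme.queries, hr, hm, Nat.cast_mul]
      have h1 := (Nat.ceil_lt_add_one
        (show 0 ≤ 4800 * (1 + Real.log p) * (Q / p) / (lam * ε) by positivity)).le
      have h2 : 1 ≤ (1 + Real.log p) * (Q / p) / (lam * ε) := by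
        rw [le_div_iff₀ hle]
        nlinarith [mul_nonneg hlogp (div_nonneg hQ0 hp'.le)]
      have h3 : 4800 * (1 + Real.log p) * (Q / p) / (lam * ε) + 1 ≤
          4801 * ((1 + Real.log p) * (Q / p) / (lam * ε)) := by
        have : 4800 * (1 + Real.log p) * (Q / p) / (lam * ε) =
          4800 * ((1 + Real.log p) * (Q / p) / (lam * ε)) := by ring
        linarith
      calc _ ≤ 4801 * ((1 + Real.log p) * (Q / p) / (lam * ε)) * (2 * p) :=
            mul_le_mul (h1.trans h3) (sum_batchSize_le G) (Nat.cast_nonneg _) (by positivity)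
        _ = 9602 * (Q / (ε * lam)) * (1 + Real.log p) := by field_simp; ring
    obtain ⟨h1, h2⟩ := bounds _ hN
    exact ⟨S, by rw [hm]; exact one_pos, h1, h2, hS⟩
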